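/- Let $B$ and $\mathcal A$ be unital complex Banach algebras, and let $(\mathcal A,E,\varepsilon)$ be a Banach $B$-$B$-non-commutative probability space: $\varepsilon:B\otimes B^{\mathrm{op}}\to\mathcal A$ is a unital homomorphism whose restrictions $L_b=\varepsilon(b\otimes 1)$ and $R_b=\varepsilon(1\otimes b)$ are injective and bounded in $b$, and $E:\mathcal A\to B$ is a bounded linear map with $E(L_{b_1}R_{b_2}Z)=b_1E(Z)b_2$ and $E(ZL_b)=E(ZR_b)$ for all $b,b_1,b_2\in B$, $Z\in\mathcal A$. Let $\mathcal A_\ell$ (resp. $\mathcal A_r$) be the algebra of all elements commuting with every $R_b$ (resp. every $L_b$). Let $\kappa^B_\chi$ denote the operator-valued bi-free cumulants, $$\kappa^B_\chi(Z_1,\dots,Z_n)=\sum_{\sigma\in BNC(\chi)}E^B_\sigma(Z_1,\dots,Z_n)\,\mu_{BNC}(\sigma,1_\chi),$$ where $BNC(\chi)$ is the set of bi-non-crossing partitions for $\chi:\{1,\dots,n\}\to\{\ell,r\}$, $\mu_{BNC}$ is its Möbius function, and $E^B$ is the bi-multiplicative moment function with $E^B_{1_\chi}(Z_1,\dots,Z_n)=E(Z_1\cdots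 Z_n)$. Write $\chi_{n,0}$ and $\chi_{0,n}$ for the constant maps with value $\ell$ and $r$. For $X\in\mathcal A_\ell$ and $Y\in\mathcal A_r$ set $$\Phi_{\ell,X}(b)=\sum_{n\ge1}\kappa^B_{\chi_{n,0}}(L_bX,\dots,L_bX),\qquad \Psi_{\ell,X}(b)=\sum_{n\ge1}E((L_bX)^n),$$ $$\Phi_{r,Y}(d)=\sum_{n\ge1}\kappa^B_{\chi_{0,n}}(R_dY,\dots,R_dY),\qquad \Psi_{r,Y}(d)=\sum_{n\ge1}E((R_dY)^n).$$ For a function $F$ near $0\in B$, let $F^{\langle-1\rangle}$ denote its compositional inverse near $0$ (with $F^{\langle -1\rangle}(0)=0$), and let $b^{-1}F^{\langle-1\rangle}(b)$ (resp. $F^{\langle-1\rangle}(d)d^{-1}$) denote the analytic function $\theta$ near $0$ with $F^{\langle-1\rangle}(b)=b\,\theta(b)$ (resp. $F^{\langle-1\rangle}(d)=\theta(d)\,d$). If $E(X)$ is invertible in $B$, then $\Phi_{\ell,X}$ and $\Psi_{\ell,X}$ converge absolutely near $0$, the functions below exist, and for all $b$ in a neighbourhood of $0$ $$b^{-1}\Phi^{\langle-1\rangle}_{\ell,X}(b)=(1+b)\,b^{-1}\Psi^{\langle-1\rangle}_{\ell,X}(b).$$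 If $E(Y)$ is invertible in $B$, then $\Phi_{r,Y}$ and $\Psi_{r,Y}$ converge absolutely near $0$, the functions below exist, and for all $d$ in a neighbourhood of $0$ $$\Phi^{\langle-1\rangle}_{r,Y}(d)\,d^{-1}=\Psi^{\langle-1\rangle}_{r,Y}(d)\,d^{-1}(1+d).$$ That is, the left and right $S$-transforms defined through the cumulant series (left-hand sides) coincide near $0$ with those of Dykema defined through the moment series (right-hand sides). -/

import Mathlib

open Filter Topology
open scoped TensorProduct

/-! ### Bi-non-crossing partitions -/

/-- The two kinds of operators. -/
inductive Side : Type
  | left : Side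
  | right : Side
  deriving DecidableEq

/-- The positions listed in the order `s_χ(1), …, s_χ(n)`: the left positions in increasing order,
followed by the right positions in decreasing order. -/
def chiOrder {n : ℕ} (χ : Fin n → Side) : List (Fin n) :=
  (List.finRange n).filter (fun k => χ k = Side.left) ++
    ((List.finRange n).filter (fun k => χ k = Side.right)).reverse

/-- The strict total order `i ≺_χ j`: left positions come first, in increasing order, and right
positions come afterwards, in decreasing order. -/
def ChiLT {n : ℕ} (χ : Fin n → Side) (i j : Fin n) : Prop :=
  (χ i = Side.left ∧ χ j = Side.left ∧ i < j) ∨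
  (χ i = Side.left ∧ χ j = Side.right) ∨
  (χ i = Side.right ∧ χ j = Side.right ∧ j < i)

instance {n : ℕ} (χ : Fin n → Side) : DecidableRel (ChiLT χ) := fun i j => by
  unfold ChiLT; infer_instance

/-- A partition of `{1, …, n}` is bi-non-crossing with respect to `χ` if it has no crossing in the
order `≺_χ`. -/
def IsBiNonCrossing {n : ℕ} (χ : Fin n → Side)
    (π : Finpartition (Finset.univ : Finset (Fin n))) : Prop :=
  ∀ U ∈ π.parts, ∀ V ∈ π.parts, ∀ u₁ ∈ U, ∀ u₂ ∈ U, ∀ v₁ ∈ V, ∀ v₂ ∈ V,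
    ChiLT χ u₁ v₁ → ChiLT χ v₁ u₂ → ChiLT χ u₂ v₂ → U = V

/-- `BNC(χ)`, ordered by refinement. -/
abbrev BNC {n : ℕ} (χ : Fin n → Side) : Type :=
  {π : Finpartition (Finset.univ : Finset (Fin n)) // IsBiNonCrossing χ π}

noncomputable instance {n : ℕ} (χ : Fin n → Side) : Fintype (BNC χ) :=
  Fintype.ofFinite _

open Classical in
noncomputable instance {n : ℕ} (χ : Fin n → Side) : LocallyFiniteOrder (BNC χ) :=
  Fintype.toLocallyFiniteOrder

/-- The full partition `1_χ`, with one block. -/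
def BNC.full {n : ℕ} (χ : Fin n → Side) : BNC χ :=
  ⟨⊤, fun U hU V hV _ _ _ _ _ _ _ _ _ _ _ => by
    have h1 := Finpartition.parts_top_subset _ hU
    have h2 := Finpartition.parts_top_subset _ hV
    rw [Finset.mem_singleton] at h1 h2
    rw [h1, h2]⟩

open Classical in
/-- The bi-non-crossing Möbius function: the Möbius function of the finite poset `BNC(χ)`. -/
noncomputable def muBNC {n : ℕ} (χ : Fin n → Side) (σ π : BNC χ) : ℂ :=
  IncidenceAlgebra.mu ℂ σ π

/-- The blocks of a partition, listed so that their `≺_χ`-minimal elements decrease. When `π` is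
bi-non-crossing, each block in this list is a `χ`-interval of its union with the later ones. -/
def blockList {n : ℕ} (χ : Fin n → Side)
    (π : Finpartition (Finset.univ : Finset (Fin n))) : List (Finset (Fin n)) :=
  (((chiOrder χ).reverse).filter (fun k => ∀ j ∈ π.part k, ¬ ChiLT χ j k)).map π.part

/-- The `≺_χ`-largest position in the blocks `Q` that precedes all of `V`, if there is one. -/
def predPos {n : ℕ} (χ : Fin n → Side) (V : Finset (Fin n)) (Q : List (Finset (Fin n))) :
    Option (Fin n) :=
  (chiOrder χ).reverse.find? (fun k => (∃ W ∈ Q, k ∈ W) ∧ ∀ v ∈ V, ChiLT χ k v)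

/-! ### `B`-`B`-non-commutative probability spaces -/

/-- A `B`-`B`-non-commutative probability space structure on the unital algebra `A`. -/
structure BBSpace (B A : Type*) [Ring B] [Algebra ℂ B] [Ring A] [Algebra ℂ A] where
  /-- the unital homomorphism `ε : B ⊗ Bᵒᵖ → A` -/
  ε : B ⊗[ℂ] Bᵐᵒᵖ →ₐ[ℂ] A
  /-- the expectation -/
  E : A →ₗ[ℂ] B
  injective_left : Function.Injective (fun b : B => ε (b ⊗ₜ[ℂ] (1 : Bᵐᵒᵖ)))
  injective_right : Function.Injective (fun b : B => ε ((1 : B) ⊗ₜ[ℂ] MulOpposite.op b))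
  E_ε_mul : ∀ (b₁ b₂ : B) (Z : A), E (ε (b₁ ⊗ₜ[ℂ] MulOpposite.op b₂) * Z) = b₁ * E Z * b₂
  E_mul_ε : ∀ (b : B) (Z : A),
    E (Z * ε (b ⊗ₜ[ℂ] (1 : Bᵐᵒᵖ))) = E (Z * ε ((1 : B) ⊗ₜ[ℂ] MulOpposite.op b))

namespace BBSpace

section Algebraic

variable {B A : Type*} [Ring B] [Algebra ℂ B] [Ring A] [Algebra ℂ A] (P : BBSpace B A)

/-- `L_b = ε(b ⊗ 1)`. -/
def L (b : B) : A := P.ε (b ⊗ₜ[ℂ] (1 : Bᵐᵒᵖ))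

/-- `R_b = ε(1 ⊗ b)`; it is anti-multiplicative in `b`. -/
def R (b : B) : A := P.ε ((1 : B) ⊗ₜ[ℂ] MulOpposite.op b)

/-- The left algebra `A_ℓ`: the commutant of all `R_b`. -/
def leftAlg : Subalgebra ℂ A := Subalgebra.centralizer ℂ (Set.range P.R)

/-- The right algebra `A_r`: the commutant of all `L_b`. -/
def rightAlg : Subalgebra ℂ A := Subalgebra.centralizer ℂ (Set.range P.L)

/-- The moment of a single block: `E` of the product of the entries `Z k`, `k ∈ V`, in the natural
order of the positions. -/
def blockMoment {n : ℕ} (V : Finset (Fin n)) (Z : Fin n → A) : B :=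
  P.E (((V.sort (· ≤ ·)).map Z).prod)

/-- The reduction of a list of blocks by bi-multiplicativity. The head `V` is a `χ`-interval, and
its moment `c` is
* multiplied on the left of the rest if nothing in the other blocks precedes `V`;
* multiplied on the right of the rest if nothing in the other blocks follows `V`;
* otherwise inserted at the nearest preceding position `p` of the other blocks, where `Z p` is
  replaced by `Z p * L c` if `p` is a left position and by `R c * Z p` if it is a right one. -/
def momentAux {n : ℕ} (χ : Fin n → Side) : List (Finset (Fin n)) → (Fin n → A) → B
  | [], _ => 1
  | V :: Q, Z =>
    match predPos χ V Q with
    | none => P.blockMoment V Z * momentAux χ Q Z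
    | some p =>
      if ∃ W ∈ Q, ∃ k ∈ W, ∀ v ∈ V, ChiLT χ v k then
        match χ p with
        | Side.left => momentAux χ Q (Function.update Z p (Z p * P.L (P.blockMoment V Z)))
        | Side.right => momentAux χ Q (Function.update Z p (P.R (P.blockMoment V Z) * Z p))
      else momentAux χ Q Z * P.blockMoment V Z

/-- The operator-valued bi-free moment function `E^B_π(Z_1, …, Z_n)`: the bi-multiplicative
function with `E^B_{1_χ}(Z_1, …, Z_n) = E(Z_1 ⋯ Z_n)`. -/
def moment {n : ℕ} (χ : Fin n → Side) (π : BNC χ) (Z : Fin n → A) : B :=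
  P.momentAux χ (blockList χ π.1) Z

open Classical in
/-- The operator-valued bi-free cumulant function
`κ^B_π(Z_1, …, Z_n) = ∑_{σ ≤ π} E^B_σ(Z_1, …, Z_n) μ_BNC(σ, π)`. -/
noncomputable def cumulant {n : ℕ} (χ : Fin n → Side) (π : BNC χ) (Z : Fin n → A) : B :=
  ∑ σ : BNC χ with σ ≤ π, muBNC χ σ π • P.moment χ σ Z

/-- The `n`-th left cumulant `κ^B_{χ_{n,0}}(L_b X, …, L_b X)`. -/
noncomputable def leftCumulantTerm (X : A) (n : ℕ) (b : B) : B :=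
  P.cumulant (fun _ : Fin n => Side.left) (BNC.full _) (fun _ => P.L b * X)

/-- The `n`-th right cumulant `κ^B_{χ_{0,n}}(R_d Y, …, R_d Y)`. -/
noncomputable def rightCumulantTerm (Y : A) (n : ℕ) (d : B) : B :=
  P.cumulant (fun _ : Fin n => Side.right) (BNC.full _) (fun _ => P.R d * Y)

end Algebraic

section Banach

variable {B A : Type*} [NormedRing B] [NormedAlgebra ℂ B] [NormedRing A] [NormedAlgebra ℂ A]
  (P : BBSpace B A)

/-- The boundedness conditions of a Banach `B`-`B`-non-commutative probability space (`A` and `B`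
being Banach algebras): `E`, `b ↦ L_b` and `b ↦ R_b` are bounded. -/
structure IsBanach : Prop where
  bounded_E : ∃ C : ℝ, ∀ Z : A, ‖P.E Z‖ ≤ C * ‖Z‖
  bounded_L : ∃ C : ℝ, ∀ b : B, ‖P.L b‖ ≤ C * ‖b‖
  bounded_R : ∃ C : ℝ, ∀ b : B, ‖P.R b‖ ≤ C * ‖b‖

/-- `Φ_{ℓ,X}(b) = ∑_{n ≥ 1} κ^B_{χ_{n,0}}(L_b X, …, L_b X)`. -/
noncomputable def leftPhi (X : A) (b : B) : B := ∑' n : ℕ, P.leftCumulantTerm X (n + 1) b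

/-- `Φ_{r,Y}(d) = ∑_{n ≥ 1} κ^B_{χ_{0,n}}(R_d Y, …, R_d Y)`. -/
noncomputable def rightPhi (Y : A) (d : B) : B := ∑' n : ℕ, P.rightCumulantTerm Y (n + 1) d

/-- `Ψ_{ℓ,X}(b) = ∑_{n ≥ 1} E((L_b X)^n)`. -/
noncomputable def leftPsi (X : A) (b : B) : B := ∑' n : ℕ, P.E ((P.L b * X) ^ (n + 1))

/-- `Ψ_{r,Y}(d) = ∑_{n ≥ 1} E((R_d Y)^n)`. -/
noncomputable def rightPsi (Y : A) (d : B) : B := ∑' n : ℕ, P.E ((P.R d * Y) ^ (n + 1))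

end Banach

end BBSpace

section Inverses

variable {B : Type*} [NormedRing B] [NormedAlgebra ℂ B]

/-- `G` is the compositional inverse of `F` near zero (as a germ at zero). -/
def IsCompInverse (F G : B → B) : Prop :=
  G 0 = 0 ∧ ContinuousAt G 0 ∧ (∀ᶠ b in 𝓝 (0 : B), F (G b) = b) ∧ ∀ᶠ b in 𝓝 (0 : B), G (F b) = b

/-- `θ` is the analytic function `b ↦ b⁻¹ G(b)` near zero. -/
def IsLeftQuotient (G θ : B → B) : Prop :=
  AnalyticAt ℂ θ 0 ∧ ∀ᶠ b in 𝓝 (0 : B), G b = b * θ b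

/-- `θ` is the analytic function `d ↦ G(d) d⁻¹` near zero. -/
def IsRightQuotient (G θ : B → B) : Prop :=
  AnalyticAt ℂ θ 0 ∧ ∀ᶠ d in 𝓝 (0 : B), G d = θ d * d

end Inverses

namespace BBSpace

variable {B A : Type*} [NormedRing B] [NormedAlgebra ℂ B] [NormedRing A] [NormedAlgebra ℂ A]
  (P : BBSpace B A)

/-- `S` is (near zero) the left `S`-transform `b ↦ b⁻¹ Φ_{ℓ,X}^{⟨-1⟩}(b)` of `X`. -/
def IsLeftSTransform (X : A) (S : B → B) : Prop :=
  ∃ G : B → B, IsCompInverse (P.leftPhi X) G ∧ IsLeftQuotient G S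

/-- `S` is (near zero) the right `S`-transform `d ↦ Φ_{r,Y}^{⟨-1⟩}(d) d⁻¹` of `Y`. -/
def IsRightSTransform (Y : A) (S : B → B) : Prop :=
  ∃ G : B → B, IsCompInverse (P.rightPhi Y) G ∧ IsRightQuotient G S

/-- `S` is (near zero) Dykema's left `S`-transform `b ↦ (1 + b) b⁻¹ Ψ_{ℓ,X}^{⟨-1⟩}(b)`. -/
def IsDykemaLeftSTransform (X : A) (S : B → B) : Prop :=
  ∃ H T : B → B, IsCompInverse (P.leftPsi X) H ∧ IsLeftQuotient H T ∧
    ∀ᶠ b in 𝓝 (0 : B), S b = (1 + b) * T b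

/-- `S` is (near zero) Dykema's right `S`-transform `d ↦ Ψ_{r,Y}^{⟨-1⟩}(d) d⁻¹ (1 + d)`. -/
def IsDykemaRightSTransform (Y : A) (S : B → B) : Prop :=
  ∃ H T : B → B, IsCompInverse (P.rightPsi Y) H ∧ IsRightQuotient H T ∧
    ∀ᶠ d in 𝓝 (0 : B), S d = T d * (1 + d)

end BBSpace

/-!
Listing the positions in the order `≺_χ` turns bi-non-crossing partitions into non-crossing ones,
and a non-crossing partition is a binary tree: the first letter is followed by the positions below
it, up to the next letter of its block, and then by the rest. Cutting a word at the block of its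
first letter expresses its moment through a cumulant whose arguments have absorbed moments of
shorter words. Summed over all words, this says that the cumulant series `K` and the moment series
`M` satisfy `K(b M(b)) = M(b)`.

Let `N(b) = b⁻¹ Ψ_{ℓ,X}(b)` and `m(b) = b (1 + N(b) b)`. For the moments of the variables `L_b X`
the functional equation becomes `Φ ∘ m = Ψ`. The derivative `b ↦ b E(X)` of `Ψ` at zero is
invertible, so `Ψ^{⟨-1⟩}` exists, and `m ∘ Ψ^{⟨-1⟩}`, which is `b ↦ (1 + b) Ψ^{⟨-1⟩}(b)`, is inverse
to `Φ`. On the right `N(d) = Ψ_{r,Y}(d) d⁻¹` and `m ∘ Ψ^{⟨-1⟩}` is `d ↦ Ψ^{⟨-1⟩}(d) (1 + d)`. On the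
left the functional equation first gives `Φ(m(b)) m(b) = Ψ(b) m(b)`; the factor `m(b)` is cancelled
where `b` is invertible, and analyticity extends the identity to a neighbourhood of zero.
-/

section NonCrossingTrees

variable {γ δ : Type*} {c : ℕ → γ} {d : ℕ → δ} {i j k m : ℕ}

/-- The first position after `i` with the same colour as `i`, capped at `j`. A partition of an
interval of positions is encoded throughout by a colouring whose colour classes are the blocks. -/
noncomputable def nextSame (c : ℕ → γ) (i j : ℕ) : ℕ := sInf {m | i < m ∧ (j ≤ m ∨ c m = c i)}

lemma nextSame_mem (c : ℕ → γ) (i j : ℕ) :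
    i < nextSame c i j ∧ (j ≤ nextSame c i j ∨ c (nextSame c i j) = c i) :=
  Nat.sInf_mem (s := {m | i < m ∧ (j ≤ m ∨ c m = c i)})
    ⟨max (i + 1) j, by simp, .inl (le_max_right _ _)⟩

lemma lt_nextSame (c : ℕ → γ) (i j : ℕ) : i < nextSame c i j := (nextSame_mem c i j).1

lemma nextSame_le (h : i < j) : nextSame c i j ≤ j := Nat.sInf_le ⟨h, .inl le_rfl⟩

lemma color_nextSame (h : nextSame c i j < j) : c (nextSame c i j) = c i :=
  (nextSame_mem c i j).2.resolve_left h.not_ge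

lemma color_ne_of_lt_nextSame (him : i < m) (hm : m < nextSame c i j) : c m ≠ c i :=
  fun h => Nat.notMem_of_lt_sInf hm ⟨him, .inr h⟩

lemma nextSame_eq (him : i < m) (hmj : m ≤ j) (hm : m < j → c m = c i)
    (h : ∀ k, i < k → k < m → c k ≠ c i) : nextSame c i j = m := by
  refine le_antisymm (Nat.sInf_le ⟨him, ?_⟩) (not_lt.1 fun hlt => ?_)
  · exact hmj.eq_or_lt.imp (fun h => h.ge) hm
  · exact h _ (lt_nextSame c i j) hlt (color_nextSame (hlt.trans_le hmj))

lemma nextSame_of_nextSame_le (hm : nextSame c i j ≤ m) (hmj : m ≤ j) :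
    nextSame c i m = nextSame c i j :=
  nextSame_eq (lt_nextSame c i j) hm (fun h => color_nextSame (h.trans_le hmj))
    fun _ hk hk' => color_ne_of_lt_nextSame hk hk'

/-- The colour classes have no crossing among the positions `i, …, j - 1`. -/
def NonCrossingOn (c : ℕ → γ) (i j : ℕ) : Prop :=
  ∀ ⦃a b p q⦄, i ≤ a → a < b → b < p → p < q → q < j → c a = c p → c b = c q → c a = c b

lemma NonCrossingOn.mono (h : NonCrossingOn c i j) (hi : i ≤ k) (hj : m ≤ j) :
    NonCrossingOn c k m :=
  fun _ _ _ _ ha hab hbp hpq hq => h (hi.trans ha) hab hbp hpq (hq.trans_le hj)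

lemma NonCrossingOn.color_ne (h : NonCrossingOn c i j) {a b : ℕ} (hia : i < a)
    (ha : a < nextSame c i j) (hb : nextSame c i j ≤ b) (hbj : b < j) : c a ≠ c b := by
  intro hab
  have hs := color_nextSame (hb.trans_lt hbj)
  refine color_ne_of_lt_nextSame hia ha ?_
  rcases hb.eq_or_lt with rfl | hb
  · rw [hab, hs]
  · exact (h le_rfl hia ha hb hbj hs.symm hab).symm

/-- The binary tree of a colouring of `i, …, j - 1`: below the root `i`, the left subtree describes
the positions up to the next one in the block of `i`, and the right subtree the remaining ones. -/
noncomputable def treeOf (c : ℕ → γ) (i j : ℕ) : BinaryTree Unit :=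
  if h : i < j then .node () (treeOf c (i + 1) (nextSame c i j)) (treeOf c (nextSame c i j) j)
  else .nil
termination_by j - i
decreasing_by
  all_goals have := lt_nextSame c i j; have := nextSame_le (c := c) h; omega

lemma treeOf_of_lt (h : i < j) :
    treeOf c i j =
      .node () (treeOf c (i + 1) (nextSame c i j)) (treeOf c (nextSame c i j) j) := by
  rw [treeOf, dif_pos h]

lemma treeOf_of_le (h : j ≤ i) : treeOf c i j = .nil := by
  rw [treeOf, dif_neg h.not_gt]

lemma treeOf_self (c : ℕ → γ) (i : ℕ) : treeOf c i i = .nil := treeOf_of_le le_rfl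

lemma interval_induction (c : ℕ → γ) {p : ℕ → ℕ → Prop} (self : ∀ i, p i i)
    (lt : ∀ i j, i < j → p (i + 1) (nextSame c i j) → p (nextSame c i j) j → p i j) :
    ∀ {i j}, i ≤ j → p i j := by
  intro i j hij
  induction h : j - i using Nat.strong_induction_on generalizing i j with
  | _ n ih =>
    rcases hij.eq_or_lt with rfl | hlt
    · exact self i
    · have h₁ := lt_nextSame c i j
      have h₂ := nextSame_le (c := c) hlt
      exact lt i j hlt (ih _ (by omega) h₁ rfl) (ih _ (by omega) h₂ rfl)

lemma numNodes_treeOf (c : ℕ → γ) (hij : i ≤ j) : (treeOf c i j).numNodes = j - i := by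
  refine interval_induction c (p := fun i j => (treeOf c i j).numNodes = j - i) ?_ ?_ hij
  · intro i; simp [treeOf_self]
  · intro i j hij hl hr
    have h₁ := lt_nextSame c i j
    have h₂ := nextSame_le (c := c) hij
    rw [treeOf_of_lt hij, BinaryTree.numNodes, hl, hr]
    omega

lemma treeOf_eq_nil_iff (hij : i ≤ j) : treeOf c i j = .nil ↔ i = j := by
  refine ⟨fun h => ?_, fun h => treeOf_of_le h.ge⟩
  have := numNodes_treeOf c hij
  rw [h, BinaryTree.numNodes] at this
  omega

lemma treeOf_congr (h : ∀ a b, i ≤ a → a < j → i ≤ b → b < j → (c a = c b ↔ d a = d b))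
    (hij : i ≤ j) : treeOf c i j = treeOf d i j := by
  revert h
  refine interval_induction c (p := fun i j => (∀ a b, i ≤ a → a < j → i ≤ b → b < j →
    (c a = c b ↔ d a = d b)) → treeOf c i j = treeOf d i j) ?_ ?_ hij
  · intro i _; simp only [treeOf_self]
  · intro i j hij hl hr h
    have h₁ := lt_nextSame c i j
    have h₂ := nextSame_le (c := c) hij
    have hnext : nextSame d i j = nextSame c i j := nextSame_eq h₁ h₂
      (fun hlt => (h _ _ h₁.le hlt le_rfl hij).1 (color_nextSame hlt))
      fun k hik hk => by
        rw [Ne, ← h k i hik.le (hk.trans_le h₂) le_rfl hij]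
        exact color_ne_of_lt_nextSame hik hk
    rw [treeOf_of_lt hij, treeOf_of_lt hij, hnext]
    congr 1
    · exact hl fun a b ha ha' hb hb' => h a b (by omega) (by omega) (by omega) (by omega)
    · exact hr fun a b ha ha' hb hb' => h a b (by omega) (by omega) (by omega) (by omega)

/-- The blocks of the tree `t` rooted at the position `i` are monochromatic for `c`. -/
def Compatible (c : ℕ → γ) : ℕ → BinaryTree Unit → Prop
  | _, .nil => True
  | i, .node _ l r => (r = .nil ∨ c i = c (i + 1 + l.numNodes)) ∧
      Compatible c (i + 1) l ∧ Compatible c (i + 1 + l.numNodes) r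

lemma compatible_treeOf_iff (hd : NonCrossingOn d i j) (hij : i ≤ j) :
    Compatible c i (treeOf d i j) ↔ ∀ a b, i ≤ a → a < b → b < j → d a = d b → c a = c b := by
  revert hd
  refine interval_induction d (p := fun i j => NonCrossingOn d i j →
    (Compatible c i (treeOf d i j) ↔ ∀ a b, i ≤ a → a < b → b < j → d a = d b → c a = c b))
    ?_ ?_ hij
  · intro i _
    simp only [treeOf_self, Compatible, true_iff]
    omega
  · intro i j hij hl hr hd
    have h₁ := lt_nextSame d i j
    have h₂ := nextSame_le (c := d) hij
    have hs : i + 1 + (treeOf d (i + 1) (nextSame d i j)).numNodes = nextSame d i j := by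
      rw [numNodes_treeOf d h₁]; omega
    rw [treeOf_of_lt hij, Compatible, hs, hl (hd.mono (by omega) h₂), hr (hd.mono h₁.le le_rfl),
      treeOf_eq_nil_iff h₂]
    constructor
    · rintro ⟨hroot, hleft, hright⟩ a b ha hab hb heq
      rcases lt_or_ge a (nextSame d i j) with has | has
      · rcases ha.eq_or_lt with rfl | ha
        · have hsb : nextSame d i j ≤ b :=
            not_lt.1 fun hbs => color_ne_of_lt_nextSame hab hbs heq.symm
          have hds := color_nextSame (hsb.trans_lt hb)
          rw [hroot.resolve_left (by omega)]
          rcases hsb.eq_or_lt with h | h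
          · rw [← h]
          · exact hright _ _ le_rfl h hb (hds.trans heq)
        · have hbs : b < nextSame d i j :=
            not_le.1 fun hbs => hd.color_ne ha has hbs hb heq
          exact hleft a b ha hab hbs heq
      · exact hright a b has hab hb heq
    · intro h
      refine ⟨h₂.eq_or_lt.imp id fun hlt => h _ _ le_rfl h₁ hlt (color_nextSame hlt).symm,
        fun a b ha hab hb => h a b (by omega) hab (by omega),
        fun a b ha hab hb => h a b (by omega) hab hb⟩

lemma nonCrossingOn_of_split (hl : NonCrossingOn c (i + 1) m) (hr : NonCrossingOn c m j)
    (hroot : m < j → c i = c m) (hi : ∀ a, i < a → a < m → c a ≠ c i)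
    (hsep : ∀ a b, i < a → a < m → m ≤ b → b < j → c a ≠ c b) : NonCrossingOn c i j := by
  intro a b p q ha hab hbp hpq hq hap hbq
  rcases lt_or_ge a m with ham | ham
  · rcases ha.eq_or_lt with rfl | ha
    · have hmp : m ≤ p := not_lt.1 fun hpm => hi p (hab.trans hbp) hpm hap.symm
      have hmb : m ≤ b := not_lt.1 fun hbm => hsep b q hab hbm (hmp.trans hpq.le) hq hbq
      rw [hroot (hmp.trans_lt (hpq.trans hq))] at hap ⊢
      rcases hmb.eq_or_lt with rfl | hmb
      · rfl
      · exact hr le_rfl hmb hbp hpq hq hap hbq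
    · have hpm : p < m := not_le.1 fun hmp => hsep a p ha ham hmp (hpq.trans hq) hap
      have hqm : q < m :=
        not_le.1 fun hmq => hsep b q (ha.trans hab) (hbp.trans hpm) hmq hq hbq
      exact hl ha hab hbp hpq hqm hap hbq
  · exact hr ham hab hbp hpq hq hap hbq

lemma NonCrossingOn.congr {d : ℕ → γ} (hd : NonCrossingOn d i j)
    (h : ∀ a, i ≤ a → a < j → c a = d a) : NonCrossingOn c i j := by
  intro a b p q ha hab hbp hpq hq
  rw [h a ha (by omega), h b (by omega) (by omega), h p (by omega) (by omega), h q (by omega) hq]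
  exact hd ha hab hbp hpq hq

lemma exists_coloring_glue {dl dr : ℕ → ℕ} (him : i < m) (hmj : m ≤ j)
    (hl : ∀ a, i + 1 ≤ a → a < m → i + 1 ≤ dl a ∧ dl a < m)
    (hr : ∀ a, m ≤ a → a < j → m ≤ dr a ∧ dr a < j) :
    ∃ c : ℕ → ℕ, (∀ a, i + 1 ≤ a → a < m → c a = dl a) ∧ (∀ a, m ≤ a → a < j → c a = dr a) ∧
      (m < j → c i = c m) ∧ (i ≤ c i ∧ c i < j) ∧ ∀ a, i < a → a < m → c a ≠ c i := by
  let c : ℕ → ℕ := fun a =>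
    if a = i then (if m < j then dr m else i) else if a < m then dl a else dr a
  have hci : c i = if m < j then dr m else i := if_pos rfl
  have hcl : ∀ a, i + 1 ≤ a → a < m → c a = dl a := fun a ha ham => by
    simp only [c, if_neg (show a ≠ i by omega), if_pos ham]
  have hcr : ∀ a, m ≤ a → a < j → c a = dr a := fun a ha _ => by
    simp only [c, if_neg (show a ≠ i by omega), if_neg ha.not_gt]
  refine ⟨c, hcl, hcr, fun h => by rw [hci, hcr m le_rfl h, if_pos h], ?_, fun a ha ham => ?_⟩
  · grind
  · have := hl a ha ham
    rw [hci, hcl a ha ham]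
    grind

lemma exists_treeOf_eq (t : BinaryTree Unit) (i : ℕ) :
    ∃ c : ℕ → ℕ, NonCrossingOn c i (i + t.numNodes) ∧
      (∀ a, i ≤ a → a < i + t.numNodes → i ≤ c a ∧ c a < i + t.numNodes) ∧
      treeOf c i (i + t.numNodes) = t := by
  induction t generalizing i with
  | nil => exact ⟨id, by intro; simp; omega, by simp; omega, treeOf_self _ _⟩
  | node _ l r hl hr =>
    obtain ⟨dl, hdl, hl_mem, hl⟩ := hl (i + 1)
    obtain ⟨dr, hdr, hr_mem, hr⟩ := hr (i + 1 + l.numNodes)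
    have hj : i + (l.numNodes + r.numNodes + 1) = i + 1 + l.numNodes + r.numNodes := by omega
    simp only [BinaryTree.numNodes, hj]
    generalize hm : i + 1 + l.numNodes = m at *
    generalize hj' : m + r.numNodes = j at *
    obtain ⟨c, hcl, hcr, hroot, hci, hi⟩ :=
      exists_coloring_glue (show i < m by omega) (show m ≤ j by omega) hl_mem hr_mem
    have hsep : ∀ a b, i < a → a < m → m ≤ b → b < j → c a ≠ c b := fun a b ha ham hb hbj => by
      have := hl_mem a ha ham
      have := hr_mem b hb hbj
      rw [hcl a ha ham, hcr b hb hbj]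
      omega
    refine ⟨c, nonCrossingOn_of_split (hdl.congr hcl) (hdr.congr hcr) hroot hi hsep, ?_, ?_⟩
    · grind
    · have hnext : nextSame c i j = m :=
        nextSame_eq (by omega) (by omega) (fun h => (hroot h).symm) hi
      rw [treeOf_of_lt (by omega), hnext, ← hl, ← hr]
      congr 1
      · exact treeOf_congr (fun a b ha ham hb hbm => by rw [hcl a ha ham, hcl b hb hbm]) (by omega)
      · exact treeOf_congr (fun a b ha ham hb hbm => by rw [hcr a ha ham, hcr b hb hbm]) (by omega)

end NonCrossingTrees

section MomentCumulantPairs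

open BinaryTree (treesOfNumNodesEq mem_treesOfNumNodesEq)

variable {γ B : Type*} [Ring B] {F q : List B → B} {c : ℕ → γ} {x : ℕ → B} {i j k m s : ℕ}

/-- A functional of words in `B` that is `B`-linear on the right in the last letter. -/
def RightLinear (f : List B → B) : Prop := ∀ l y b, f (l ++ [y * b]) = f (l ++ [y]) * b

/-- A functional of words in `B` that is additive in each letter. -/
def AdditiveInEntries (f : List B → B) : Prop :=
  ∀ l₁ l₂ y z, f (l₁ ++ (y + z) :: l₂) = f (l₁ ++ y :: l₂) + f (l₁ ++ z :: l₂)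

/-- The sum of `q` over the words obtained from `acc ++ l` by choosing letters of `l` that contain
its first one and multiplying each of them by the value of `F` on the letters of `l` strictly
between it and the next chosen one. -/
def peel (F q : List B → B) (acc : List B) : List B → B
  | [] => q acc
  | y :: l => ∑ k ∈ Finset.range (l.length + 1),
      peel F q (acc ++ [y * F (l.take k)]) (l.drop k)
termination_by l => l.length
decreasing_by simp

/-- `F` and `q` are related like a moment functional and its free cumulant functional: `F` is
recovered by summing over the possible blocks of the first letter. -/
structure IsMomentCumulantPair (F q : List B → B) : Prop where
  nil : F [] = 1
  eq_peel : ∀ l, F l = peel F q [] l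

/-- The letters of the block of the root `i` of `t`, each multiplied by the value under `f` of the
subtree between it and the next letter of that block. -/
def treeWord (f : List B → B) (x : ℕ → B) : ℕ → BinaryTree Unit → List B
  | _, .nil => []
  | i, .node _ l r => (x i * f (treeWord f x (i + 1) l)) :: treeWord f x (i + 1 + l.numNodes) r

/-- The word that the non-crossing colouring `c` of `i, …, j - 1` attaches to the block of `i`. -/
noncomputable def coloringWord (f : List B → B) (c : ℕ → γ) (x : ℕ → B) (i j : ℕ) : List B :=
  treeWord f x i (treeOf c i j)

lemma coloringWord_self (f : List B → B) (c : ℕ → γ) (x : ℕ → B) (i : ℕ) :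
    coloringWord f c x i i = [] := by
  rw [coloringWord, treeOf_self, treeWord]

lemma coloringWord_of_lt (f : List B → B) (x : ℕ → B) (hij : i < j) :
    coloringWord f c x i j = (x i * f (coloringWord f c x (i + 1) (nextSame c i j))) ::
      coloringWord f c x (nextSame c i j) j := by
  have := lt_nextSame c i j
  rw [coloringWord, treeOf_of_lt hij, treeWord, numNodes_treeOf c (lt_nextSame c i j),
    show i + 1 + (nextSame c i j - (i + 1)) = nextSame c i j by omega]
  rfl

/-- Positions after `j` that share no block with those before `j` hang off the last letter. -/
lemma exists_coloringWord_eq_concat (hF : RightLinear F) (hF₀ : F [] = 1) (hij : i < j)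
    (hjk : j ≤ k) (hsep : ∀ a b, i ≤ a → a < j → j ≤ b → b < k → c a ≠ c b) :
    ∃ l y, coloringWord F c x i j = l ++ [y] ∧
      coloringWord F c x i k = l ++ [y * F (coloringWord F c x j k)] := by
  suffices H : i < j → (∀ a b, i ≤ a → a < j → j ≤ b → b < k → c a ≠ c b) →
      ∃ l y, coloringWord F c x i j = l ++ [y] ∧
        coloringWord F c x i k = l ++ [y * F (coloringWord F c x j k)] from H hij hsep
  refine interval_induction c (p := fun i j => j ≤ k → i < j →
    (∀ a b, i ≤ a → a < j → j ≤ b → b < k → c a ≠ c b) →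
      ∃ l y, coloringWord F c x i j = l ++ [y] ∧
        coloringWord F c x i k = l ++ [y * F (coloringWord F c x j k)]) (by simp) ?_ hij.le hjk
  intro i j hij hl hr hjk _ hsep
  have h₁ := lt_nextSame c i j
  rw [coloringWord_of_lt F x hij, coloringWord_of_lt F x (hij.trans_le hjk)]
  rcases (nextSame_le (c := c) hij).eq_or_lt with hs | hs
  · have hk : nextSame c i k = k := nextSame_eq (hij.trans_le hjk) le_rfl (by omega)
      fun a hia hak => by
        rcases lt_or_ge a j with haj | haj
        · exact color_ne_of_lt_nextSame hia (hs ▸ haj)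
        · exact (hsep i a le_rfl hij haj hak).symm
    rw [hs] at hl ⊢
    rw [hk, coloringWord_self, coloringWord_self]
    refine ⟨[], _, rfl, ?_⟩
    rcases (show i + 1 ≤ j from hij).eq_or_lt with rfl | hij'
    · simp [coloringWord_self, hF₀]
    · obtain ⟨l, y, hly, hlk⟩ := hl hjk hij' fun a b ha => hsep a b (by omega)
      rw [hlk, hF, hly, mul_assoc, List.nil_append]
  · have hk : nextSame c i k = nextSame c i j :=
      nextSame_eq h₁ (by omega) (fun _ => color_nextSame hs)
        fun _ hia ha => color_ne_of_lt_nextSame hia ha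
    obtain ⟨l, y, hly, hlk⟩ := hr hjk hs fun a b ha => hsep a b (by omega)
    rw [hk, hly, hlk]
    exact ⟨_ :: l, y, rfl, rfl⟩

lemma RightLinear.coloringWord_mul (hF : RightLinear F) (hF₀ : F [] = 1) (hij : i ≤ j)
    (hjk : j ≤ k) (hsep : ∀ a b, i ≤ a → a < j → j ≤ b → b < k → c a ≠ c b) :
    F (coloringWord F c x i j) * F (coloringWord F c x j k) = F (coloringWord F c x i k) := by
  rcases hij.eq_or_lt with rfl | hij
  · rw [coloringWord_self, hF₀, one_mul]
  · obtain ⟨l, y, hly, hlk⟩ := exists_coloringWord_eq_concat (x := x) hF hF₀ hij hjk hsep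
    rw [hlk, hF, hly]

open Classical in
lemma filter_Icc_succ (hij : i < j) :
    {m ∈ Finset.Icc (i + 1) j | m = j ∨ c m = c i} =
      {m ∈ Finset.Icc (nextSame c i j) j | m = j ∨ c m = c (nextSame c i j)} := by
  ext m
  have := lt_nextSame c i j
  have := nextSame_le (c := c) hij
  have := @color_nextSame _ c i j
  have := @color_ne_of_lt_nextSame _ c i j m
  grind

open Classical in
/-- Cutting the word of the block of `s` in two amounts to choosing the position `m` of that block
at which the second part starts. -/
lemma sum_take_drop_coloringWord (g : List B → List B → B) (hsj : s ≤ j) :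
    ∑ k ∈ Finset.range ((coloringWord F c x s j).length + 1),
      g ((coloringWord F c x s j).take k) ((coloringWord F c x s j).drop k) =
    ∑ m ∈ Finset.Icc s j with m = j ∨ c m = c s,
      g (coloringWord F c x s m) (coloringWord F c x m j) := by
  refine interval_induction c (p := fun s j => ∀ g : List B → List B → B,
    ∑ k ∈ Finset.range ((coloringWord F c x s j).length + 1),
      g ((coloringWord F c x s j).take k) ((coloringWord F c x s j).drop k) =
    ∑ m ∈ Finset.Icc s j with m = j ∨ c m = c s,
      g (coloringWord F c x s m) (coloringWord F c x m j)) ?_ ?_ hsj g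
  · intro i g
    simp [coloringWord_self, Finset.filter_singleton]
  · intro i j hij _ hr g
    have h₁ := lt_nextSame c i j
    have h₂ := nextSame_le (c := c) hij
    set s := nextSame c i j
    have hindex : {m ∈ Finset.Icc i j | m = j ∨ c m = c i} =
        insert i {m ∈ Finset.Icc s j | m = j ∨ c m = c s} := by
      rw [← filter_Icc_succ hij]
      grind
    have hword : ∀ m ∈ {m ∈ Finset.Icc s j | m = j ∨ c m = c s}, coloringWord F c x i m =
        (x i * F (coloringWord F c x (i + 1) s)) :: coloringWord F c x s m := by
      intro m hm
      simp only [Finset.mem_filter, Finset.mem_Icc] at hm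
      rw [coloringWord_of_lt F x (h₁.trans_le hm.1.1), nextSame_of_nextSame_le hm.1.1 hm.1.2]
    rw [hindex, Finset.sum_insert (by simp; omega), coloringWord_self,
      coloringWord_of_lt F x hij, List.length_cons, Finset.sum_range_succ', add_comm]
    refine congr_arg₂ _ rfl ((hr fun u v => g (_ :: u) v).trans ?_)
    exact Finset.sum_congr rfl fun m hm => by rw [hword m hm]

lemma AdditiveInEntries.peel_add (hq : AdditiveInEntries q) (l₁ l₂ l : List B) (y z : B) :
    peel F q (l₁ ++ (y + z) :: l₂) l =
      peel F q (l₁ ++ y :: l₂) l + peel F q (l₁ ++ z :: l₂) l := by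
  induction h : l.length using Nat.strong_induction_on generalizing l l₂ with
  | _ n ih =>
    match l with
    | [] => simpa only [peel] using hq l₁ l₂ y z
    | w :: l =>
      simp only [peel, ← Finset.sum_add_distrib, List.append_assoc, List.cons_append]
      exact Finset.sum_congr rfl fun k _ => ih _ (by simp at h ⊢; omega) _ _ rfl

lemma AdditiveInEntries.sum_peel (hq : AdditiveInEntries q) {ι : Type*} (t : Finset ι)
    (y : ι → B) (acc l : List B) :
    ∑ a ∈ t, peel F q (acc ++ [y a]) l = peel F q (acc ++ [∑ a ∈ t, y a]) l :=
  (map_sum (AddMonoidHom.mk' (fun z => peel F q (acc ++ [z]) l) (hq.peel_add acc [] l)) y t).symm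

lemma numNodes_eq_zero {t : BinaryTree Unit} : t.numNodes = 0 ↔ t = .nil := by
  cases t <;> simp

open Classical in
lemma sum_compatible_trees (c : ℕ → γ) (g : BinaryTree Unit → B) (hij : i < j) :
    ∑ t ∈ treesOfNumNodesEq (j - i) with Compatible c i t, g t =
    ∑ m ∈ Finset.Icc (i + 1) j with m = j ∨ c m = c i,
      ∑ l ∈ treesOfNumNodesEq (m - (i + 1)) with Compatible c (i + 1) l,
        ∑ r ∈ treesOfNumNodesEq (j - m) with Compatible c m r, g (.node () l r) := by
  simp only [Finset.sum_sigma']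
  symm
  refine Finset.sum_bij (fun t _ => .node () t.2.1 t.2.2) ?_ ?_ ?_ fun _ _ => rfl
  · rintro ⟨m, l, r⟩ h
    simp only [Finset.mem_sigma, Finset.mem_filter, Finset.mem_Icc, mem_treesOfNumNodesEq] at h ⊢
    obtain ⟨⟨hm, hroot⟩, ⟨hl, hcl⟩, hr, hcr⟩ := h
    have hm' : i + 1 + l.numNodes = m := by omega
    refine ⟨by rw [BinaryTree.numNodes]; omega, ?_⟩
    rw [Compatible, hm', ← numNodes_eq_zero]
    exact ⟨hroot.imp (by omega) Eq.symm, hcl, hcr⟩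
  · rintro ⟨m, l, r⟩ h ⟨m', l', r'⟩ h' heq
    simp only [Finset.mem_sigma, Finset.mem_filter, Finset.mem_Icc, mem_treesOfNumNodesEq] at h h'
    obtain ⟨-, rfl, rfl⟩ := BinaryTree.node.inj heq
    have hl := h.2.1.1.symm.trans h'.2.1.1
    obtain rfl : m = m' := by omega
    rfl
  · rintro (_ | ⟨_, l, r⟩) h
    · simp [mem_treesOfNumNodesEq] at h
      omega
    · simp only [Finset.mem_filter, mem_treesOfNumNodesEq, BinaryTree.numNodes, Compatible,
        ← numNodes_eq_zero] at h
      refine ⟨⟨i + 1 + l.numNodes, l, r⟩, ?_, rfl⟩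
      simp only [Finset.mem_sigma, Finset.mem_filter, Finset.mem_Icc, mem_treesOfNumNodesEq]
      exact ⟨⟨by omega, h.2.1.imp (by omega) Eq.symm⟩, ⟨by omega, h.2.2.1⟩, by omega, h.2.2.2⟩

open Classical in
/-- The sum over the non-crossing refinements of a non-crossing partition, encoded as trees. -/
lemma sum_compatible_eq_peel (hFq : IsMomentCumulantPair F q) (hF : RightLinear F)
    (hq : AdditiveInEntries q) (hij : i ≤ j) (hc : NonCrossingOn c i j) (acc : List B) :
    ∑ t ∈ treesOfNumNodesEq (j - i) with Compatible c i t, q (acc ++ treeWord q x i t) =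
      peel F q acc (coloringWord F c x i j) := by
  induction h : j - i using Nat.strong_induction_on generalizing i j acc with
  | _ n ih =>
    subst h
    rcases hij.eq_or_lt with rfl | hij
    · simp [coloringWord_self, peel, treeWord, Compatible, Finset.filter_singleton]
    have h₁ := lt_nextSame c i j
    have h₂ := nextSame_le (c := c) hij
    rw [sum_compatible_trees c _ hij, coloringWord_of_lt F x hij, peel,
      sum_take_drop_coloringWord (fun u v => peel F q (acc ++ [_ * F u]) v) h₂, filter_Icc_succ hij]
    refine Finset.sum_congr rfl fun m hm => ?_
    simp only [Finset.mem_filter, Finset.mem_Icc] at hm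
    obtain ⟨⟨hsm, hmj⟩, -⟩ := hm
    have hinner : ∀ l ∈ {l ∈ treesOfNumNodesEq (m - (i + 1)) | Compatible c (i + 1) l},
        (∑ r ∈ treesOfNumNodesEq (j - m) with Compatible c m r,
          q (acc ++ treeWord q x i (.node () l r))) =
        peel F q (acc ++ [x i * q ([] ++ treeWord q x (i + 1) l)]) (coloringWord F c x m j) := by
      intro l hl
      rw [Finset.mem_filter, mem_treesOfNumNodesEq] at hl
      rw [← ih _ (by omega) hmj (hc.mono (by omega) le_rfl) _ rfl]
      simp only [treeWord, hl.1, show i + 1 + (m - (i + 1)) = m by omega, List.append_assoc,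
        List.singleton_append, List.nil_append]
    rw [Finset.sum_congr rfl hinner, hq.sum_peel, ← Finset.mul_sum,
      ih _ (by omega) (by omega) (hc.mono (by omega) hmj) _ rfl, ← hFq.eq_peel, mul_assoc,
      hF.coloringWord_mul hFq.nil (by omega) hsm fun a b ha has hb hbm =>
        hc.color_ne ha has hb (hbm.trans_le hmj)]

open Classical in
lemma sum_compatible_eq (hFq : IsMomentCumulantPair F q) (hF : RightLinear F)
    (hq : AdditiveInEntries q) {n : ℕ} (hc : NonCrossingOn c 0 n) :
    ∑ t ∈ treesOfNumNodesEq n with Compatible c 0 t, q (treeWord q x 0 t) =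
      F (coloringWord F c x 0 n) := by
  rw [hFq.eq_peel, ← sum_compatible_eq_peel hFq hF hq n.zero_le hc, Nat.sub_zero]
  simp only [List.nil_append]

lemma coloringWord_of_const {a : γ} (hF₀ : F [] = 1)
    (hc : ∀ v < j, c v = a) (hij : i ≤ j) (b : B) :
    coloringWord F c (fun _ => b) i j = List.replicate (j - i) b := by
  induction h : j - i generalizing i with
  | zero => rw [show i = j by omega, coloringWord_self, List.replicate_zero]
  | succ l ih =>
    have hnext : nextSame c i j = i + 1 := nextSame_eq i.lt_succ_self (by omega)
      (fun h => (hc _ h).trans (hc i (by omega)).symm) (by omega)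
    rw [coloringWord_of_lt F _ (by omega), hnext, coloringWord_self, hF₀, mul_one,
      ih (by omega) (by omega), List.replicate_succ]

lemma IsMomentCumulantPair.cumulant_nil (h : IsMomentCumulantPair F q) :
    q [] = 1 := by
  rw [← h.nil, h.eq_peel, peel]

end MomentCumulantPairs

section ChiOrder

variable {n : ℕ} {χ : Fin n → Side} {e : Equiv.Perm (Fin n)}

/-- The permutation `e` is the permutation `s_χ`: it lists the positions in the order `≺_χ`. -/
structure IsChiEnumeration (χ : Fin n → Side) (e : Equiv.Perm (Fin n)) : Prop where
  chiOrder_eq : chiOrder χ = (List.finRange n).map e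
  chiLT_iff : ∀ i j, ChiLT χ (e i) (e j) ↔ i < j

lemma isChiEnumeration_left (n : ℕ) :
    IsChiEnumeration (fun _ : Fin n => Side.left) (Equiv.refl _) where
  chiOrder_eq := by simp [chiOrder]
  chiLT_iff i j := by simp [ChiLT]

lemma isChiEnumeration_right (n : ℕ) :
    IsChiEnumeration (fun _ : Fin n => Side.right) Fin.revPerm where
  chiOrder_eq := by simp [chiOrder, List.finRange_reverse]
  chiLT_iff i j := by simp [ChiLT]

/-- The block of the `k`-th position in the order listed by `e`, as a colouring of `ℕ`; the junk
colour `∅` is used outside of the range of positions. -/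
def blockAt (e : Equiv.Perm (Fin n)) (π : Finpartition (Finset.univ : Finset (Fin n))) (k : ℕ) :
    Finset (Fin n) :=
  if h : k < n then π.part (e ⟨k, h⟩) else ∅

lemma blockAt_fin (e : Equiv.Perm (Fin n)) (π : Finpartition (Finset.univ : Finset (Fin n)))
    (k : Fin n) : blockAt e π k = π.part (e k) :=
  dif_pos k.2

lemma nonCrossingOn_blockAt (he : IsChiEnumeration χ e)
    {π : Finpartition (Finset.univ : Finset (Fin n))} :
    NonCrossingOn (blockAt e π) 0 n ↔ IsBiNonCrossing χ π := by
  constructor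
  · intro h U hU V hV u₁ hu₁ u₂ hu₂ v₁ hv₁ v₂ hv₂ h₁ h₂ h₃
    obtain ⟨a, rfl⟩ := e.surjective u₁
    obtain ⟨b, rfl⟩ := e.surjective v₁
    obtain ⟨p, rfl⟩ := e.surjective u₂
    obtain ⟨q, rfl⟩ := e.surjective v₂
    rw [he.chiLT_iff] at h₁ h₂ h₃
    rw [← π.part_eq_iff_mem hU, ← blockAt_fin] at hu₁ hu₂
    rw [← π.part_eq_iff_mem hV, ← blockAt_fin] at hv₁ hv₂
    rw [← hu₁, ← hv₁]
    exact h (Nat.zero_le _) h₁ h₂ h₃ q.2 (hu₁.trans hu₂.symm) (hv₁.trans hv₂.symm)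
  · intro h a b p q _ hab hbp hpq hq hap hbq
    have hp := hpq.trans hq
    have hb := hbp.trans hp
    have ha := hab.trans hb
    lift a to Fin n using ha
    lift b to Fin n using hb
    lift p to Fin n using hp
    lift q to Fin n using hq
    simp only [blockAt_fin] at hap hbq ⊢
    have hmem : ∀ k, e k ∈ π.part (e k) := fun k => π.mem_part_self.2 (Finset.mem_univ _)
    have hpart : ∀ k, π.part (e k) ∈ π.parts := fun k => π.part_mem.2 (Finset.mem_univ _)
    exact h _ (hpart a) _ (hpart b) _ (hmem a) _ (hap ▸ hmem p) _ (hmem b) _ (hbq ▸ hmem q)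
      ((he.chiLT_iff _ _).2 hab) ((he.chiLT_iff _ _).2 hbp) ((he.chiLT_iff _ _).2 hpq)

lemma finpartition_univ_le_iff {α : Type*} [Fintype α] [DecidableEq α]
    {π σ : Finpartition (Finset.univ : Finset α)} :
    π ≤ σ ↔ ∀ x y, π.part x = π.part y → σ.part x = σ.part y := by
  constructor
  · intro h x y hxy
    obtain ⟨V, hV, hle⟩ := h (π.part_mem.2 (Finset.mem_univ x))
    rw [σ.part_eq_of_mem hV (hle (π.mem_part_self.2 (Finset.mem_univ x))),
      σ.part_eq_of_mem hV (hle (hxy ▸ π.mem_part_self.2 (Finset.mem_univ y)))]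
  · intro h U hU
    obtain ⟨x, hx⟩ := π.nonempty_of_mem_parts hU
    refine ⟨σ.part x, σ.part_mem.2 (Finset.mem_univ x), fun y hy => ?_⟩
    rw [σ.mem_part_iff_part_eq_part (Finset.mem_univ y) (Finset.mem_univ x)]
    exact h y x (by rw [π.part_eq_of_mem hU hx, π.part_eq_of_mem hU hy])

lemma le_iff_blockAt {π σ : Finpartition (Finset.univ : Finset (Fin n))} :
    π ≤ σ ↔ ∀ a b, 0 ≤ a → a < b → b < n →
      blockAt e π a = blockAt e π b → blockAt e σ a = blockAt e σ b := by
  rw [finpartition_univ_le_iff]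
  constructor
  · intro h a b _ hab hb
    lift a to Fin n using by omega
    lift b to Fin n using hb
    simpa only [blockAt_fin] using h (e a) (e b)
  · intro h x y hxy
    obtain ⟨a, rfl⟩ := e.surjective x
    obtain ⟨b, rfl⟩ := e.surjective y
    simp only [← blockAt_fin] at hxy ⊢
    rcases lt_trichotomy a b with hab | rfl | hab
    · exact h a b a.1.zero_le hab b.2 hxy
    · rfl
    · exact (h b a b.1.zero_le hab a.2 hxy.symm).symm

open BinaryTree (treesOfNumNodesEq mem_treesOfNumNodesEq)

lemma le_iff_compatible (he : IsChiEnumeration χ e) {τ σ : BNC χ} :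
    τ ≤ σ ↔ Compatible (blockAt e σ.1) 0 (treeOf (blockAt e τ.1) 0 n) := by
  rw [compatible_treeOf_iff ((nonCrossingOn_blockAt he).2 τ.2) n.zero_le, ← le_iff_blockAt]
  rfl

lemma treeOf_blockAt_injective (he : IsChiEnumeration χ e) :
    Function.Injective fun τ : BNC χ => treeOf (blockAt e τ.1) 0 n := by
  intro τ σ h
  have hrefl : ∀ ρ : BNC χ, Compatible (blockAt e ρ.1) 0 (treeOf (blockAt e ρ.1) 0 n) :=
    fun ρ => (le_iff_compatible he).1 le_rfl
  refine le_antisymm ((le_iff_compatible he).2 ?_) ((le_iff_compatible he).2 ?_)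
  · exact (congrArg _ h).mpr (hrefl σ)
  · exact (congrArg _ h).mp (hrefl τ)

open Classical in
lemma exists_treeOf_blockAt_eq (he : IsChiEnumeration χ e) {t : BinaryTree Unit}
    (ht : t.numNodes = n) : ∃ τ : BNC χ, treeOf (blockAt e τ.1) 0 n = t := by
  obtain ⟨c, hc, -, hct⟩ := exists_treeOf_eq t 0
  rw [ht, zero_add] at hc hct
  let s : Setoid (Fin n) := Setoid.ker fun k => c (e.symm k)
  have hblock : ∀ a b, a < n → b < n →
      (blockAt e (Finpartition.ofSetoid s) a = blockAt e (Finpartition.ofSetoid s) b ↔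
        c a = c b) := by
    intro a b ha hb
    rw [blockAt, blockAt, dif_pos ha, dif_pos hb, eq_comm,
      ← Finpartition.mem_part_iff_part_eq_part _ (Finset.mem_univ _) (Finset.mem_univ _),
      Finpartition.mem_part_ofSetoid_iff_rel]
    simp [s, Setoid.ker_def]
  refine ⟨⟨.ofSetoid s, (nonCrossingOn_blockAt he).1 fun a b p q h0 hab hbp hpq hq hap hbq => ?_⟩,
    (treeOf_congr (fun a b _ ha _ hb => hblock a b ha hb) n.zero_le).trans hct⟩
  rw [hblock _ _ (by omega) (by omega)] at hap hbq ⊢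
  exact hc h0 hab hbp hpq hq hap hbq

open Classical in
lemma sum_le_eq_sum_compatible {B : Type*} [AddCommMonoid B] (he : IsChiEnumeration χ e)
    (g : BinaryTree Unit → B) (σ : BNC χ) :
    ∑ τ : BNC χ with τ ≤ σ, g (treeOf (blockAt e τ.1) 0 n) =
      ∑ t ∈ treesOfNumNodesEq n with Compatible (blockAt e σ.1) 0 t, g t := by
  refine Finset.sum_bij (fun τ _ => treeOf (blockAt e τ.1) 0 n) (fun τ hτ => ?_)
    (fun τ _ τ' _ h => treeOf_blockAt_injective he h) (fun t ht => ?_) fun _ _ => rfl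
  · rw [Finset.mem_filter, mem_treesOfNumNodesEq, numNodes_treeOf _ n.zero_le]
    exact ⟨rfl, (le_iff_compatible he).1 (Finset.mem_filter.1 hτ).2⟩
  · rw [Finset.mem_filter, mem_treesOfNumNodesEq] at ht
    obtain ⟨τ, rfl⟩ := exists_treeOf_blockAt_eq he ht.1
    exact ⟨τ, by simpa [le_iff_compatible he] using ht.2, rfl⟩

lemma le_full (σ : BNC χ) : σ ≤ BNC.full χ :=
  le_top (a := σ.1)

open Classical in
lemma sum_muBNC_smul_sum_le {B : Type*} [AddCommGroup B] [Module ℂ B] (f : BNC χ → B) :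
    ∑ σ : BNC χ, muBNC χ σ (BNC.full χ) • ∑ τ : BNC χ with τ ≤ σ, f τ = f (BNC.full χ) := by
  have hmu : ∀ τ : BNC χ, ∑ σ : BNC χ with τ ≤ σ, muBNC χ σ (BNC.full χ) =
      if τ = BNC.full χ then 1 else 0 := fun τ => by
    rw [← IncidenceAlgebra.sum_Icc_mu_left (𝕜 := ℂ) τ (BNC.full χ)]
    refine Finset.sum_congr (by ext σ; simp [le_full]) fun σ _ => ?_
    unfold muBNC
    congr!
  calc ∑ σ : BNC χ, muBNC χ σ (BNC.full χ) • ∑ τ : BNC χ with τ ≤ σ, f τ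
      = ∑ τ : BNC χ, (∑ σ : BNC χ with τ ≤ σ, muBNC χ σ (BNC.full χ)) • f τ := by
        simp only [Finset.sum_filter, Finset.smul_sum, Finset.sum_smul, ite_smul, smul_ite,
          zero_smul, smul_zero]
        exact Finset.sum_comm
    _ = f (BNC.full χ) := by
        simp only [hmu, ite_smul, one_smul, zero_smul, Finset.sum_ite_eq', Finset.mem_univ, if_true]

lemma blockAt_top {k : ℕ} (hk : k < n) : blockAt e ⊤ k = Finset.univ := by
  rw [blockAt, dif_pos hk]
  exact Finset.mem_singleton.1 (Finpartition.parts_top_subset _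
    ((Finpartition.part_mem _).2 (Finset.mem_univ _)))

end ChiOrder

section Moments

variable {γ B : Type*} [Ring B] {n k m : ℕ} {F : List B → B} {c : ℕ → γ} {x : ℕ → B}

lemma coloringWord_eq_map_filter [DecidableEq γ] (F : List B → B) (c : ℕ → γ) (x : ℕ → B)
    {i j : ℕ} (hij : i ≤ j) :
    coloringWord F c x i j = ((List.Ico i j).filter (c · = c i)).map
      fun v => x v * F (coloringWord F c x (v + 1) (nextSame c v j)) := by
  refine interval_induction c (p := fun i j => coloringWord F c x i j =
    ((List.Ico i j).filter (c · = c i)).map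
      fun v => x v * F (coloringWord F c x (v + 1) (nextSame c v j))) ?_ ?_ hij
  · intro i
    simp [coloringWord_self]
  · intro i j hij _ hr
    have h₁ := lt_nextSame c i j
    have h₂ := nextSame_le (c := c) hij
    set s := nextSame c i j
    have hrange : List.Ico i j =
        i :: (List.Ico (i + 1) s ++ List.Ico s j) := by
      rw [List.Ico.append_consecutive h₁ h₂, List.Ico.eq_cons hij]
    have hmiddle : (List.Ico (i + 1) s).filter (c · = c i) = [] := by
      simp only [List.filter_eq_nil_iff, List.Ico.mem, decide_eq_true_eq]
      exact fun v hv => color_ne_of_lt_nextSame (j := j) (by omega) (by omega)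
    have hright : (List.Ico s j).filter (c · = c i) =
        (List.Ico s j).filter (c · = c s) := by
      rcases h₂.eq_or_lt with h | h
      · simp [h]
      · rw [color_nextSame h]
    rw [coloringWord_of_lt F x hij, hr, hrange, List.filter_cons_of_pos (by simp),
      List.filter_append, hmiddle, List.nil_append, hright, List.map_cons]

/-- The end of the longest interval of positions starting at `k`, bounded by `m`, that avoids the
blocks of the positions before `k`. -/
noncomputable def gapEnd (c : ℕ → γ) (m k : ℕ) : ℕ :=
  sInf {w | k ≤ w ∧ (m ≤ w ∨ ∃ a < k, c a = c w)}

lemma gapEnd_mem (c : ℕ → γ) (m k : ℕ) :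
    k ≤ gapEnd c m k ∧ (m ≤ gapEnd c m k ∨ ∃ a < k, c a = c (gapEnd c m k)) :=
  Nat.sInf_mem (s := {w | k ≤ w ∧ (m ≤ w ∨ ∃ a < k, c a = c w)}) ⟨max k m, by simp⟩

lemma gapEnd_eq {w : ℕ} (hkw : k ≤ w) (hw : m ≤ w ∨ ∃ a < k, c a = c w)
    (h : ∀ v, k ≤ v → v < w → v < m ∧ ∀ a < k, c a ≠ c v) : gapEnd c m k = w := by
  refine le_antisymm (Nat.sInf_le ⟨hkw, hw⟩) (not_lt.1 fun hlt => ?_)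
  obtain ⟨hk, hm⟩ := gapEnd_mem c m k
  obtain ⟨hm', hne⟩ := h _ hk hlt
  exact hm.elim hm'.not_ge fun ⟨a, ha, h⟩ => hne a ha h

lemma gapEnd_le (hkm : k ≤ m) : gapEnd c m k ≤ m := Nat.sInf_le ⟨hkm, .inl le_rfl⟩

lemma color_ne_of_lt_gapEnd {v a : ℕ} (hkv : k ≤ v) (hv : v < gapEnd c m k) (ha : a < k) :
    c a ≠ c v :=
  fun h => Nat.notMem_of_lt_sInf hv ⟨hkv, .inr ⟨a, ha, h⟩⟩

lemma gapEnd_succ_of_not_first (hk : ¬ ∀ j < k + 1, c j ≠ c (k + 1)) :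
    gapEnd c m (k + 1) = k + 1 := by
  push Not at hk
  exact gapEnd_eq le_rfl (.inr hk) (by omega)

lemma NonCrossingOn.gapEnd_succ (hc : NonCrossingOn c 0 m) (hkm : k ≤ m) {v : ℕ} (hkv : k ≤ v)
    (hv : v < gapEnd c m k) (hck : c v = c k) :
    gapEnd c m (v + 1) = nextSame c v (gapEnd c m k) := by
  have h₁ := lt_nextSame c v (gapEnd c m k)
  have h₂ := nextSame_le (c := c) hv
  have h₃ := gapEnd_le (c := c) hkm
  refine gapEnd_eq h₁ ?_ fun u hvu hu => ⟨by omega, fun a hav hau => ?_⟩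
  · rcases h₂.eq_or_lt with h | h
    · rw [h]
      exact (gapEnd_mem c m k).2.imp id fun ⟨a, ha, hac⟩ => ⟨a, by omega, hac⟩
    · exact .inr ⟨v, by omega, (color_nextSame h).symm⟩
  · have huv := color_ne_of_lt_nextSame hvu hu
    have hka : k ≤ a := not_lt.1 fun hak =>
      color_ne_of_lt_gapEnd (hkv.trans (by omega)) (hu.trans_le h₂) hak hau
    have hak : k ≠ a := by rintro rfl; exact huv (hau.symm.trans hck.symm)
    have hav' : a ≠ v := by rintro rfl; exact huv hau.symm
    have := hc k.zero_le (show k < a by omega) (show a < v by omega) hvu (by omega) hck.symm hau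
    exact huv (by rw [← hau, ← this, hck])

/-- The word of a block with first position `k`, all of whose positions are before `m`. -/
lemma NonCrossingOn.coloringWord_gapEnd [DecidableEq γ] (hc : NonCrossingOn c 0 n) (hmn : m ≤ n)
    (hkm : k < m) (hk : ∀ j < k, c j ≠ c k) (hm : ∀ v, m ≤ v → v < n → c k ≠ c v) :
    coloringWord F c x k (gapEnd c m k) = ((List.range n).filter (c · = c k)).map
      fun v => x v * F (coloringWord F c x (v + 1) (gapEnd c m (v + 1))) := by
  have h₁ : k ≤ gapEnd c m k := (gapEnd_mem c m k).1
  have h₂ := gapEnd_le (c := c) hkm.le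
  have hlt : k < gapEnd c m k := h₁.lt_of_ne fun h => (gapEnd_mem c m k).2.elim (by omega)
    fun ⟨a, ha, hac⟩ => hk a ha (hac.trans (by rw [← h]))
  have hfilter : (List.range n).filter (c · = c k) =
      (List.Ico k (gapEnd c m k)).filter (c · = c k) := by
    rw [← List.Ico.zero_bot, ← List.Ico.append_consecutive k.zero_le (h₁.trans (h₂.trans hmn)),
      ← List.Ico.append_consecutive h₁ (h₂.trans hmn), List.filter_append, List.filter_append,
      List.filter_eq_nil_iff.2, List.filter_eq_nil_iff (l := List.Ico _ n).2, List.nil_append,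
      List.append_nil]
    · simp only [List.Ico.mem, decide_eq_true_eq]
      intro v ⟨hv, hvn⟩ hck
      rcases (gapEnd_mem c m k).2 with hmw | ⟨a, ha, hac⟩
      · exact hm v (by omega) hvn hck.symm
      · rcases hv.eq_or_lt with rfl | hv
        · exact hk a ha (hac.trans hck)
        · exact hk a ha (hc a.zero_le ha hlt hv hvn hac hck.symm)
    · simp only [List.Ico.mem, decide_eq_true_eq]
      exact fun v hv => hk v hv.2
  rw [coloringWord_eq_map_filter F c x h₁, hfilter]
  refine List.map_congr_left fun v hv => ?_
  simp only [List.mem_filter, List.Ico.mem, decide_eq_true_eq] at hv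
  rw [(hc.mono le_rfl hmn).gapEnd_succ hkm.le hv.1.1 (by omega) hv.2]

/-- The letter at the position `v` when the blocks with first position after `k` are reduced: the
letters from `k` on have absorbed the moments of the reduced blocks that follow them. -/
noncomputable def reducedLetter (F : List B → B) (c : ℕ → γ) (x : ℕ → B) (m k v : ℕ) : B :=
  x v * if k ≤ v then F (coloringWord F c x (v + 1) (gapEnd c m (v + 1))) else 1

lemma reducedLetter_of_le {v : ℕ} (h : k ≤ v) : reducedLetter F c x m k v =
    x v * F (coloringWord F c x (v + 1) (gapEnd c m (v + 1))) := by
  rw [reducedLetter, if_pos h]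

lemma reducedLetter_of_lt {v : ℕ} (h : v < k) :
    reducedLetter F c x m k v = x v := by
  rw [reducedLetter, if_neg h.not_ge, mul_one]

lemma reducedLetter_succ {v : ℕ} (h : v ≠ k) :
    reducedLetter F c x m (k + 1) v = reducedLetter F c x m k v := by
  simp only [reducedLetter, show k + 1 ≤ v ↔ k ≤ v by omega]

lemma reducedLetter_self (hF₀ : F [] = 1) (h : gapEnd c m (k + 1) = k + 1) :
    reducedLetter F c x m k k = x k := by
  rw [reducedLetter_of_le le_rfl, h, coloringWord_self, hF₀, mul_one]

lemma reducedLetter_last (hF₀ : F [] = 1) {v : ℕ} (h : v < k + 1) :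
    reducedLetter F c x (k + 1) k v = x v := by
  rcases Nat.lt_succ_iff_lt_or_eq.1 h with hv | rfl
  · exact reducedLetter_of_lt hv
  · exact reducedLetter_self hF₀ (gapEnd_eq le_rfl (.inl le_rfl) (by omega))

lemma update_eq_reducedLetter {A : Type*} {e : Equiv.Perm (Fin n)} {z : B → A} {Z : Fin n → A}
    (hkn : k < n)
    (hZ : ∀ v : Fin n, v < m → Z (e v) = z (reducedLetter F c x m (k + 1) v)) (v : Fin n)
    (hv : v < m) :
    Function.update Z (e ⟨k, hkn⟩) (z (reducedLetter F c x m k k)) (e v) =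
      z (reducedLetter F c x m k v) := by
  by_cases hvk : (v : ℕ) = k
  · obtain rfl : v = ⟨k, hkn⟩ := Fin.ext hvk
    rw [Function.update_self]
  · rw [Function.update_of_ne (by simpa [Fin.ext_iff] using hvk), hZ v hv, reducedLetter_succ hvk]

open Classical in
/-- The blocks with first position before `k`, those with the largest first position coming first:
the lists of blocks met by the recursion defining `BBSpace.momentAux`. -/
noncomputable def blocksBelow (c : ℕ → γ) (k : ℕ) : List γ :=
  ((List.range k).reverse.filter fun v => ∀ j < v, c j ≠ c v).map c

lemma blocksBelow_succ_of_first (hk : ∀ j < k, c j ≠ c k) :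
    blocksBelow c (k + 1) = c k :: blocksBelow c k := by
  rw [blocksBelow, List.range_succ, List.reverse_append, List.reverse_singleton,
    List.singleton_append, List.filter_cons_of_pos (by simpa using hk), List.map_cons]
  rfl

lemma blocksBelow_succ_of_not_first (hk : ¬ ∀ j < k, c j ≠ c k) :
    blocksBelow c (k + 1) = blocksBelow c k := by
  rw [blocksBelow, List.range_succ, List.reverse_append, List.reverse_singleton,
    List.singleton_append, List.filter_cons_of_neg (by simpa using hk)]
  rfl

lemma mem_blocksBelow {V : γ} : V ∈ blocksBelow c k ↔ ∃ j < k, c j = V := by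
  induction k with
  | zero => simp [blocksBelow]
  | succ k ih =>
    by_cases hk : ∀ j < k, c j ≠ c k
    · rw [blocksBelow_succ_of_first hk, List.mem_cons, ih]
      simp only [Nat.lt_succ_iff_lt_or_eq, or_and_right, exists_or, exists_eq_left,
        eq_comm (a := V)]
      exact or_comm
    · rw [blocksBelow_succ_of_not_first hk, ih]
      push Not at hk
      obtain ⟨j, hj, hjk⟩ := hk
      refine ⟨fun ⟨i, hi, h⟩ => ⟨i, by omega, h⟩, fun ⟨i, hi, h⟩ => ?_⟩
      rcases Nat.lt_succ_iff_lt_or_eq.1 hi with hi | rfl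
      · exact ⟨i, hi, h⟩
      · exact ⟨j, hj, hjk.trans h⟩

section Blocks

variable {χ : Fin n → Side} {e : Equiv.Perm (Fin n)}
  {π : Finpartition (Finset.univ : Finset (Fin n))}

lemma mem_blockAt {j : ℕ} (hj : j < n) (v : Fin n) :
    e v ∈ blockAt e π j ↔ blockAt e π v = blockAt e π j := by
  rw [blockAt_fin, blockAt, dif_pos hj,
    π.mem_part_iff_part_eq_part (Finset.mem_univ _) (Finset.mem_univ _)]

lemma exists_mem_blocksBelow (hk : k ≤ n) (v : Fin n) :
    (∃ W ∈ blocksBelow (blockAt e π) k, e v ∈ W) ↔ ∃ j < k, blockAt e π j = blockAt e π v := by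
  simp only [mem_blocksBelow]
  constructor
  · rintro ⟨_, ⟨j, hj, rfl⟩, hv⟩
    exact ⟨j, hj, ((mem_blockAt (by omega) v).1 hv).symm⟩
  · rintro ⟨j, hj, h⟩
    exact ⟨_, ⟨j, hj, rfl⟩, (mem_blockAt (by omega) v).2 h.symm⟩

lemma blockList_eq_blocksBelow (he : IsChiEnumeration χ e) :
    blockList χ π = blocksBelow (blockAt e π) n := by
  rw [blockList, blocksBelow, he.chiOrder_eq, ← List.map_reverse, List.filter_map, List.map_map,
    ← List.map_coe_finRange_eq_range, ← List.map_reverse, List.filter_map, List.map_map]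
  have hfirst : ∀ v : Fin n, (∀ i ∈ π.part (e v), ¬ ChiLT χ i (e v)) ↔
      ∀ j < (v : ℕ), blockAt e π j ≠ blockAt e π v := by
    intro v
    rw [e.surjective.forall]
    simp only [← blockAt_fin, he.chiLT_iff, mem_blockAt v.2]
    refine ⟨fun h j hj hjv => h ⟨j, by omega⟩ hjv hj, fun h i hi hlt => h i hlt hi⟩
  simp only [Function.comp_def, hfirst, blockAt_fin]

lemma find?_eq_some_of_pairwise {α : Type*} {r : α → α → Prop} {p : α → Bool} {a : α}
    {l : List α} (hl : l.Pairwise r) (ha : a ∈ l) (hpa : p a) (h : ∀ b, r b a → p b = false) :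
    l.find? p = some a := by
  induction l with
  | nil => simp at ha
  | cons b l ih =>
    rcases List.mem_cons.1 ha with rfl | hal
    · exact List.find?_cons_of_pos hpa
    · rw [List.pairwise_cons] at hl
      rw [List.find?_cons_of_neg (by simp [h b (hl.1 a hal)]), ih hl.2 hal]

lemma predPos_eq (he : IsChiEnumeration χ e) (hkn : k + 1 < n)
    (hk : ∀ j < k + 1, blockAt e π j ≠ blockAt e π (k + 1)) :
    predPos χ (blockAt e π (k + 1)) (blocksBelow (blockAt e π) (k + 1)) =
      some (e ⟨k, by omega⟩) := by
  rw [predPos, he.chiOrder_eq, ← List.map_reverse, List.find?_map]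
  refine congrArg _ (find?_eq_some_of_pairwise (r := (· > ·)) (a := ⟨k, by omega⟩)
    (List.pairwise_reverse.2 (List.pairwise_lt_finRange n)) (by simp) ?_ fun v hv => ?_)
  · simp only [Function.comp_apply, decide_eq_true_eq, exists_mem_blocksBelow hkn.le]
    rw [e.surjective.forall]
    simp only [he.chiLT_iff, mem_blockAt hkn]
    exact ⟨⟨k, by omega, rfl⟩, fun u hu => not_le.1 fun hle => hk u (Nat.lt_succ_of_le hle) hu⟩
  · simp only [Function.comp_apply, decide_eq_false_iff_not]
    rintro ⟨-, hlt⟩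
    have := (he.chiLT_iff v ⟨k + 1, hkn⟩).1 (hlt _ ((mem_blockAt hkn _).2 rfl))
    rw [gt_iff_lt, Fin.lt_def] at hv
    rw [Fin.lt_def] at this
    simp only at hv this
    omega

lemma predPos_nil (χ : Fin n → Side) (V : Finset (Fin n)) : predPos χ V [] = none := by
  simp [predPos]

end Blocks

end Moments

section MomentFunction

variable {B A : Type*} [Ring B] [Algebra ℂ B] [Ring A] [Algebra ℂ A] {P : BBSpace B A}
  {n k m : ℕ} {χ : Fin n → Side} {e : Equiv.Perm (Fin n)} {F : List B → B} {z : B → A}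
  {x : ℕ → B} {π : Finpartition (Finset.univ : Finset (Fin n))}

/-- The operators `z b` have the moments `F`, computed in the `χ`-order listed by `e`, and the
coefficients produced by the reduction of `BBSpace.momentAux` are absorbed in `b`. -/
structure IsWordModel (P : BBSpace B A) (χ : Fin n → Side) (e : Equiv.Perm (Fin n))
    (F : List B → B) (z : B → A) : Prop where
  blockMoment_eq : ∀ (V : Finset (Fin n)) (Z : Fin n → A) (y : Fin n → B),
    V.Nonempty → (∀ v, e v ∈ V → Z (e v) = z (y v)) →
      P.blockMoment V Z = F (((List.finRange n).filter (e · ∈ V)).map y)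
  mul_L : ∀ k, χ k = Side.left → ∀ b c, z b * P.L c = z (b * c)
  R_mul : ∀ k, χ k = Side.right → ∀ b c, P.R c * z b = z (b * c)

lemma IsWordModel.blockMoment_blockAt (hz : IsWordModel P χ e F z) (hk : k < n) {Z : Fin n → A}
    {y : ℕ → B} (hZ : ∀ v : Fin n, blockAt e π v = blockAt e π k → Z (e v) = z (y v)) :
    P.blockMoment (blockAt e π k) Z =
      F (((List.range n).filter (blockAt e π · = blockAt e π k)).map y) := by
  rw [hz.blockMoment_eq _ Z (fun v => y v) ⟨e ⟨k, hk⟩, (mem_blockAt hk _).2 rfl⟩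
      fun v hv => hZ v ((mem_blockAt hk v).1 hv),
    ← List.map_coe_finRange_eq_range, List.filter_map, List.map_map]
  simp only [mem_blockAt hk, Function.comp_def]

lemma IsWordModel.blockMoment_first (hz : IsWordModel P χ e F z)
    (hc : NonCrossingOn (blockAt e π) 0 n) (hkm : k < m) (hmn : m ≤ n)
    (hk : ∀ j < k, blockAt e π j ≠ blockAt e π k)
    (hm : ∀ v, m ≤ v → v < n → ∀ j < k + 1, blockAt e π j ≠ blockAt e π v) {Z : Fin n → A}
    (hZ : ∀ v : Fin n, v < m → Z (e v) = z (reducedLetter F (blockAt e π) x m k v)) :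
    P.blockMoment (blockAt e π k) Z =
      F (coloringWord F (blockAt e π) x k (gapEnd (blockAt e π) m k)) := by
  rw [hc.coloringWord_gapEnd hmn hkm hk fun v hmv hv => hm v hmv hv k k.lt_succ_self]
  refine hz.blockMoment_blockAt (hkm.trans_le hmn) fun v hv => ?_
  have hkv : k ≤ v := not_lt.1 fun hvk => hk v hvk hv
  have hvm : v < m := not_le.1 fun hmv => hm v hmv v.2 k k.lt_succ_self hv.symm
  rw [hZ v hvm, reducedLetter_of_le hkv]

lemma separated_of_not_exists_after (he : IsChiEnumeration χ e)
    (hc : NonCrossingOn (blockAt e π) 0 n) (hkn : k + 1 < n)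
    (hk : ∀ j < k + 1, blockAt e π j ≠ blockAt e π (k + 1))
    (h : ¬ ∃ W ∈ blocksBelow (blockAt e π) (k + 1), ∃ i ∈ W,
      ∀ v ∈ blockAt e π (k + 1), ChiLT χ v i) :
    ∀ v, k + 1 ≤ v → v < n → ∀ j < k + 1, blockAt e π j ≠ blockAt e π v := by
  intro v hkv hv j hj hjv
  have hkv' : k + 1 < v := hkv.lt_of_ne (by rintro rfl; exact hk j hj hjv)
  refine h ⟨_, mem_blocksBelow.2 ⟨j, hj, rfl⟩, e ⟨v, hv⟩, (mem_blockAt (by omega) _).2 hjv.symm,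
    ?_⟩
  rw [e.surjective.forall]
  intro u hu
  rw [mem_blockAt hkn] at hu
  rw [he.chiLT_iff, Fin.lt_def]
  refine not_le.1 fun hvu => ?_
  rcases hvu.eq_or_lt with hvu | hvu
  · exact hk j hj (hjv.trans (by rw [← hu, ← hvu]))
  · exact hk j hj (hc j.zero_le hj hkv' hvu u.2 hjv hu.symm)

lemma IsWordModel.momentAux_succ_of_first (hz : IsWordModel P χ e F z)
    (he : IsChiEnumeration χ e) (hkn : k + 1 < n)
    (hk : ∀ j < k + 1, blockAt e π j ≠ blockAt e π (k + 1)) {Z : Fin n → A} {b : B}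
    (hZ : Z (e ⟨k, by omega⟩) = z b) :
    P.momentAux χ (blocksBelow (blockAt e π) (k + 2)) Z =
      if ∃ W ∈ blocksBelow (blockAt e π) (k + 1), ∃ i ∈ W,
          ∀ v ∈ blockAt e π (k + 1), ChiLT χ v i then
        P.momentAux χ (blocksBelow (blockAt e π) (k + 1)) (Function.update Z (e ⟨k, by omega⟩)
          (z (b * P.blockMoment (blockAt e π (k + 1)) Z)))
      else P.momentAux χ (blocksBelow (blockAt e π) (k + 1)) Z *
        P.blockMoment (blockAt e π (k + 1)) Z := by
  rw [blocksBelow_succ_of_first hk, BBSpace.momentAux, predPos_eq he hkn hk]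
  cases hside : χ (e ⟨k, by omega⟩) with
  | left => simp only [hside, ← hz.mul_L _ hside, ← hZ]
  | right => simp only [hside, ← hz.R_mul _ hside, ← hZ]

/-- The reduction of `BBSpace.momentAux` computes nested moments along the forest of blocks. -/
lemma IsWordModel.momentAux_blocksBelow (hz : IsWordModel P χ e F z) (he : IsChiEnumeration χ e)
    (hF : RightLinear F) (hF₀ : F [] = 1) (hc : NonCrossingOn (blockAt e π) 0 n)
    (hkm : k < m) (hmn : m ≤ n)
    (hm : ∀ v, m ≤ v → v < n → ∀ j < k + 1, blockAt e π j ≠ blockAt e π v) {Z : Fin n → A}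
    (hZ : ∀ v : Fin n, v < m → Z (e v) = z (reducedLetter F (blockAt e π) x m k v)) :
    P.momentAux χ (blocksBelow (blockAt e π) (k + 1)) Z =
      F (coloringWord F (blockAt e π) x 0 m) := by
  induction k generalizing m Z with
  | zero =>
    have hgap : gapEnd (blockAt e π) m 0 = m := gapEnd_eq m.zero_le (.inl le_rfl) (by simp)
    rw [blocksBelow_succ_of_first (by simp), show blocksBelow (blockAt e π) 0 = [] from rfl,
      BBSpace.momentAux, predPos_nil]
    simp only [BBSpace.momentAux]
    rw [mul_one, hz.blockMoment_first hc hkm hmn (by simp) hm hZ, hgap]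
  | succ k ih =>
    have hm' : ∀ v, m ≤ v → v < n → ∀ j < k + 1, blockAt e π j ≠ blockAt e π v :=
      fun v hmv hv j hj => hm v hmv hv j (by omega)
    have hkn : k < n := by omega
    have hZk : Z (e ⟨k, hkn⟩) = z (x k) := by
      rw [hZ ⟨k, hkn⟩ (by simp only; omega), reducedLetter_of_lt (by simp)]
    have hZ' := update_eq_reducedLetter hkn hZ
    by_cases hk : ∀ j < k + 1, blockAt e π j ≠ blockAt e π (k + 1)
    · rw [hz.momentAux_succ_of_first he (by omega) hk hZk,
        hz.blockMoment_first hc hkm hmn hk hm hZ]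
      split_ifs with hafter
      · rw [reducedLetter_of_le le_rfl] at hZ'
        exact ih (by omega) hmn hm' hZ'
      · have hsep := separated_of_not_exists_after he hc (by omega) hk hafter
        have hgap : gapEnd (blockAt e π) m (k + 1) = m := gapEnd_eq hkm.le (.inl le_rfl)
          fun v hkv hvm => ⟨hvm, hsep v hkv (hvm.trans_le hmn)⟩
        have hZx : ∀ v : Fin n, v < k + 1 →
            Z (e v) = z (reducedLetter F (blockAt e π) x (k + 1) k v) := fun v hvk => by
          rw [hZ v (by omega), reducedLetter_of_lt hvk, reducedLetter_last hF₀ hvk]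
        rw [ih k.lt_succ_self (by omega) hsep hZx, hgap,
          hF.coloringWord_mul hF₀ (Nat.zero_le _) hkm.le fun i j _ hi hj hjm =>
            hsep j hj (by omega) i hi]
    · rw [blocksBelow_succ_of_not_first hk]
      rw [reducedLetter_self hF₀ (gapEnd_succ_of_not_first hk), ← hZk,
        Function.update_eq_self] at hZ'
      exact ih (by omega) hmn hm' hZ'

theorem IsWordModel.moment_eq {π : BNC χ} (hz : IsWordModel P χ e F z)
    (he : IsChiEnumeration χ e) (hF : RightLinear F) (hF₀ : F [] = 1) (hn : 0 < n) :
    P.moment χ π (fun i => z (x (e.symm i))) = F (coloringWord F (blockAt e π.1) x 0 n) := by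
  obtain ⟨k, rfl⟩ : ∃ k, n = k + 1 := ⟨n - 1, by omega⟩
  rw [BBSpace.moment, blockList_eq_blocksBelow he]
  refine hz.momentAux_blocksBelow he hF hF₀ ((nonCrossingOn_blockAt he).2 π.2) k.lt_succ_self le_rfl
    (by omega) fun v hv => ?_
  rw [e.symm_apply_apply, reducedLetter_last hF₀ hv]

theorem IsWordModel.cumulant_full_eq {q : List B → B} (hz : IsWordModel P χ e F z)
    (he : IsChiEnumeration χ e) (hFq : IsMomentCumulantPair F q) (hF : RightLinear F)
    (hq : AdditiveInEntries q) (hn : 0 < n) (b : B) :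
    P.cumulant χ (BNC.full χ) (fun _ => z b) = q (List.replicate n b) := by
  classical
  have hmoment : ∀ σ : BNC χ, P.moment χ σ (fun _ => z b) =
      ∑ τ : BNC χ with τ ≤ σ, q (coloringWord q (blockAt e τ.1) (fun _ => b) 0 n) := fun σ => by
    refine (hz.moment_eq (x := fun _ => b) he hF hFq.nil hn).trans ?_
    rw [← sum_compatible_eq hFq hF hq ((nonCrossingOn_blockAt he).2 σ.2),
      ← sum_le_eq_sum_compatible he (fun t => q (treeWord q (fun _ => b) 0 t))]
    rfl
  simp only [BBSpace.cumulant, le_full, Finset.filter_true, hmoment]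
  rw [sum_muBNC_smul_sum_le fun τ => q (coloringWord q (blockAt e τ.1) (fun _ => b) 0 n),
    coloringWord_of_const (c := blockAt e (BNC.full χ).1) hFq.cumulant_nil
      (fun v hv => blockAt_top hv) n.zero_le, Nat.sub_zero]

end MomentFunction

section Twists

variable {B : Type*} [Ring B] {F q : List B → B} {b d : B}

lemma peel_concat_singleton (hF₀ : F [] = 1) (acc : List B) (y : B) :
    peel F q acc [y] = q (acc ++ [y]) := by
  simp [peel, hF₀]

/-- The last summand is the one in which the block consists of `x` alone. -/
lemma peel_cons_concat (acc : List B) (x : B) (l : List B) (y : B) :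
    peel F q acc (x :: (l ++ [y])) =
      ∑ k ∈ Finset.range (l.length + 1), peel F q (acc ++ [x * F (l.take k)]) (l.drop k ++ [y]) +
        q (acc ++ [x * F (l ++ [y])]) := by
  rw [peel, List.length_append, List.length_singleton, Finset.sum_range_succ]
  congr 1
  · refine Finset.sum_congr rfl fun k hk => ?_
    have hk : k ≤ l.length := Nat.lt_succ_iff.1 (Finset.mem_range.1 hk)
    rw [List.take_append_of_le_length hk, List.drop_append_of_le_length hk]
  · rw [List.take_of_length_le (by simp), List.drop_of_length_le (by simp), peel]

lemma peel_concat_mul (hF₀ : F [] = 1) (hF : RightLinear F) {n : ℕ} (y b : B)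
    (hq : ∀ l : List B, l.length < n → ∀ y, q (l ++ [y * b]) = q (l ++ [y]) * b)
    {acc l : List B} (hn : acc.length + l.length < n) :
    peel F q acc (l ++ [y * b]) = peel F q acc (l ++ [y]) * b := by
  induction h : l.length using Nat.strong_induction_on generalizing acc l with
  | _ m ih =>
    subst h
    rcases l with _ | ⟨x, l⟩
    · simpa [peel_concat_singleton hF₀] using hq acc (by simpa using hn) y
    · rw [List.length_cons] at hn
      simp only [List.cons_append, peel_cons_concat, add_mul, Finset.sum_mul]
      congr 1
      · refine Finset.sum_congr rfl fun k hk => ih _ ?_ ?_ rfl <;> grind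
      · rw [hF, ← mul_assoc, hq acc (by omega)]

/-- The word `acc ++ l ++ [y]` itself is the only one of its length contributing to `peel`, so that
right linearity of `q` on it amounts to that of `peel`. -/
lemma peel_concat_mul_sub (hF₀ : F [] = 1) (hF : RightLinear F) {n : ℕ} (y b : B)
    (hq : ∀ l : List B, l.length < n → ∀ y, q (l ++ [y * b]) = q (l ++ [y]) * b)
    {acc l : List B} (hn : acc.length + l.length = n) :
    peel F q acc (l ++ [y * b]) - q (acc ++ (l ++ [y * b])) =
      (peel F q acc (l ++ [y]) - q (acc ++ (l ++ [y]))) * b := by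
  induction l generalizing acc with
  | nil => simp [peel_concat_singleton hF₀]
  | cons x l ih =>
    have key := ih (acc := acc ++ [x]) (by grind)
    simp only [List.append_assoc, List.singleton_append] at key
    simp only [List.cons_append, peel_cons_concat, Finset.sum_range_succ', List.take_zero,
      List.drop_zero, hF₀, mul_one]
    have hlast : q (acc ++ [x * F (l ++ [y * b])]) = q (acc ++ [x * F (l ++ [y])]) * b := by
      rw [hF, ← mul_assoc, hq acc (by grind)]
    have hsum : ∑ k ∈ Finset.range l.length,
        peel F q (acc ++ [x * F (l.take (k + 1))]) (l.drop (k + 1) ++ [y * b]) =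
        (∑ k ∈ Finset.range l.length,
          peel F q (acc ++ [x * F (l.take (k + 1))]) (l.drop (k + 1) ++ [y])) * b := by
      rw [Finset.sum_mul]
      exact Finset.sum_congr rfl fun k hk => peel_concat_mul hF₀ hF y b hq (by grind)
    rw [hlast, hsum, add_sub_right_comm, add_sub_assoc, key]
    noncomm_ring

lemma IsMomentCumulantPair.rightLinear_cumulant (h : IsMomentCumulantPair F q)
    (hF : RightLinear F) : RightLinear q := by
  intro l y b
  induction hn : l.length using Nat.strong_induction_on generalizing l y with
  | _ n ih =>
    have key := peel_concat_mul_sub h.nil hF y b (q := q) (acc := []) (l := l) (n := n)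
      (fun l' hl' y' => ih _ hl' l' y' rfl) (by simpa using hn)
    rw [← h.eq_peel, ← h.eq_peel, hF, sub_mul] at key
    simpa using key

/-- `leftTwist b f (y₁, …, yₙ) = b f(y₁ b, …, yₙ₋₁ b, yₙ)`: the functional of the variables `b z`
determined by the functional `f` of the variable `z`. -/
def leftTwist (b : B) (f : List B → B) (l : List B) : B :=
  match l.getLast? with
  | none => 1
  | some y => b * f (l.dropLast.map (· * b) ++ [y])

/-- `rightTwist d f (y₁, …, yₙ) = f(d y₁, …, d yₙ)`. -/
def rightTwist (d : B) (f : List B → B) (l : List B) : B := f (l.map (d * ·))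

@[simp] lemma leftTwist_nil (b : B) (f : List B → B) : leftTwist b f [] = 1 := rfl

@[simp] lemma leftTwist_concat (b : B) (f : List B → B) (l : List B) (y : B) :
    leftTwist b f (l ++ [y]) = b * f (l.map (· * b) ++ [y]) := by
  simp [leftTwist]

lemma leftTwist_mul (hF₀ : F [] = 1) (hF : RightLinear F) (l : List B) :
    leftTwist b F l * b = b * F (l.map (· * b)) := by
  induction l using List.reverseRecOn with
  | nil => simp [hF₀]
  | append_singleton l y _ => rw [leftTwist_concat, mul_assoc, ← hF]; simp

lemma RightLinear.leftTwist (hF : RightLinear F) : RightLinear (leftTwist b F) := by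
  intro l y c
  rw [leftTwist_concat, leftTwist_concat, hF, mul_assoc]

lemma AdditiveInEntries.leftTwist (hq : AdditiveInEntries q) :
    AdditiveInEntries (leftTwist b q) := by
  intro l₁ l₂ y z
  induction l₂ using List.reverseRecOn with
  | nil => simp only [leftTwist_concat, hq _ [], mul_add]
  | append_singleton l₂ x _ =>
    simp only [← List.cons_append, ← List.append_assoc, leftTwist_concat]
    simp only [List.map_append, List.map_cons, add_mul, List.append_assoc, List.cons_append]
    rw [hq, mul_add]

lemma peel_leftTwist (hF₀ : F [] = 1) (hF : RightLinear F) (acc l : List B) (y : B) :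
    peel (leftTwist b F) (leftTwist b q) acc (l ++ [y]) =
      b * peel F q (acc.map (· * b)) (l.map (· * b) ++ [y]) := by
  induction h : l.length using Nat.strong_induction_on generalizing acc l with
  | _ m ih =>
    subst h
    rcases l with _ | ⟨x, l⟩
    · rw [List.nil_append, peel_concat_singleton (leftTwist_nil b F), leftTwist_concat,
        List.map_nil, List.nil_append, peel_concat_singleton hF₀]
    · simp only [List.cons_append, List.map_cons, peel_cons_concat, leftTwist_concat, mul_add,
        Finset.mul_sum, List.length_map, mul_assoc]
      congr 1
      refine Finset.sum_congr rfl fun k hk => ?_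
      rw [ih _ (by grind) _ _ rfl]
      simp [mul_assoc, leftTwist_mul hF₀ hF]

lemma IsMomentCumulantPair.leftTwist (h : IsMomentCumulantPair F q) (hF : RightLinear F) :
    IsMomentCumulantPair (leftTwist b F) (leftTwist b q) where
  nil := leftTwist_nil b F
  eq_peel l := by
    induction l using List.reverseRecOn with
    | nil => simp [peel]
    | append_singleton l y _ =>
      rw [peel_leftTwist h.nil hF, leftTwist_concat, h.eq_peel, List.map_nil]

lemma RightLinear.rightTwist (hF : RightLinear F) : RightLinear (rightTwist d F) := by
  intro l y c
  simp only [_root_.rightTwist, List.map_append, List.map_cons, List.map_nil, ← mul_assoc, hF _ _ c]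

lemma AdditiveInEntries.rightTwist (hq : AdditiveInEntries q) :
    AdditiveInEntries (rightTwist d q) := by
  intro l₁ l₂ y z
  simp only [_root_.rightTwist, List.map_append, List.map_cons, mul_add, hq _ _ (d * y)]

lemma peel_rightTwist (acc l : List B) :
    peel (rightTwist d F) (rightTwist d q) acc l =
      peel F q (acc.map (d * ·)) (l.map (d * ·)) := by
  induction h : l.length using Nat.strong_induction_on generalizing acc l with
  | _ m ih =>
    subst h
    rcases l with _ | ⟨x, l⟩
    · simp [peel, rightTwist]
    · simp only [peel, List.map_cons, List.length_map]
      refine Finset.sum_congr rfl fun k hk => ?_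
      rw [ih _ (by grind) _ _ rfl]
      simp [mul_assoc, rightTwist]

lemma IsMomentCumulantPair.rightTwist (h : IsMomentCumulantPair F q) :
    IsMomentCumulantPair (rightTwist d F) (rightTwist d q) where
  nil := h.nil
  eq_peel l := by rw [peel_rightTwist, _root_.rightTwist, h.eq_peel, List.map_nil]

end Twists

section SplitSums

variable {α R : Type*} [AddCommMonoid R]

/-- The sum of `h` over all ways of cutting a list into nonempty consecutive pieces. -/
def splitSum (h : List (List α) → R) (l : List α) : R :=
  ∑ c : Composition l.length, h (l.splitWrtComposition c)

lemma splitSum_nil (h : List (List α) → R) : splitSum h [] = h [] := by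
  have hones (c : Composition ([] : List α).length) : c = Composition.ones 0 :=
    Composition.ext (c.blocks_eq_nil.2 rfl)
  exact Finset.sum_eq_single (Composition.ones 0) (fun c _ hc => absurd (hones c) hc) (by simp)

lemma splitSum_cons (h : List (List α) → R) (x : α) (l : List α) :
    splitSum h (x :: l) = ∑ k ∈ Finset.range (l.length + 1),
      splitSum (fun L => h ((x :: l.take k) :: L)) (l.drop k) := by
  rw [Finset.sum_range]
  simp only [splitSum]
  rw [Finset.sum_sigma']
  symm
  refine Finset.sum_bij (i := fun p _ => ⟨(p.1 + 1 : ℕ) :: p.2.blocks, ?_, ?_⟩)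
    (fun _ _ => Finset.mem_univ _) ?_ ?_ fun p _ => ?_
  · intro j hj
    rcases List.mem_cons.1 hj with rfl | hj
    exacts [Nat.succ_pos _, p.2.blocks_pos hj]
  · have := p.1.2
    rw [List.sum_cons, p.2.blocks_sum, List.length_drop, List.length_cons]
    omega
  · rintro ⟨i, c⟩ - ⟨j, d⟩ - hij
    simp only [Composition.mk.injEq, List.cons.injEq] at hij
    obtain rfl : i = j := Fin.ext (by omega)
    rw [Composition.ext hij.2]
  · intro c _
    obtain ⟨k, ns, hk⟩ := List.exists_cons_of_ne_nil fun h => by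
      simpa using c.blocks_eq_nil.1 h
    have hpos : 0 < k := c.blocks_pos (by simp [hk])
    have hsum : k + ns.sum = l.length + 1 := by
      rw [← List.sum_cons, ← hk, c.blocks_sum, List.length_cons]
    refine ⟨⟨⟨k - 1, by omega⟩, ⟨ns, fun hj => c.blocks_pos (by simp [hk, hj]), ?_⟩⟩,
      Finset.mem_univ _, Composition.ext ?_⟩
    · simp only [List.length_drop]
      omega
    · simp only [hk, Nat.sub_add_cancel hpos]
  · simp only [List.splitWrtComposition, List.splitWrtCompositionAux_cons, List.take_succ_cons,
      List.drop_succ_cons]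

end SplitSums

section PowerSeries

open FormalMultilinearSeries

variable {𝕜 U V W : Type*} [NontriviallyNormedField 𝕜] [NormedAddCommGroup U] [NormedSpace 𝕜 U]
  [NormedAddCommGroup V] [NormedSpace 𝕜 V] [NormedAddCommGroup W] [NormedSpace 𝕜 W]

/-- The value of a formal multilinear series on a list of arguments. -/
def evalList (p : FormalMultilinearSeries 𝕜 V W) (l : List V) : W := p l.length l.get

lemma evalList_ofFn (p : FormalMultilinearSeries 𝕜 V W) {n : ℕ} (v : Fin n → V) :
    evalList p (List.ofFn v) = p n v :=
  p.congr (by simp) fun i h1 h2 => by simp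

lemma evalList_replicate (p : FormalMultilinearSeries 𝕜 V W) (n : ℕ) (b : V) :
    evalList p (List.replicate n b) = p n fun _ => b := by
  rw [← List.ofFn_const, evalList_ofFn]

lemma evalList_append_add (p : FormalMultilinearSeries 𝕜 V W) (l₁ l₂ : List V) (x y : V) :
    evalList p (l₁ ++ (x + y) :: l₂) =
      evalList p (l₁ ++ x :: l₂) + evalList p (l₁ ++ y :: l₂) := by
  have key (z : V) : evalList p (l₁ ++ z :: l₂) = p (l₁ ++ (0 : V) :: l₂).length
      (Function.update (l₁ ++ (0 : V) :: l₂).get ⟨l₁.length, by simp⟩ z) := by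
    refine p.congr (by simp) fun i h₁ h₂ => ?_
    simp only [Function.update_apply, Fin.mk.injEq]
    grind
  rw [key, key, key, ContinuousMultilinearMap.map_update_add]

lemma evalList_comp (q : FormalMultilinearSeries 𝕜 W U) (p : FormalMultilinearSeries 𝕜 V W)
    (l : List V) :
    evalList (q.comp p) l = splitSum (fun L => evalList q (L.map (evalList p))) l := by
  rw [evalList, FormalMultilinearSeries.comp, sum_apply, splitSum]
  refine Finset.sum_congr rfl fun c _ => ?_
  rw [compAlongComposition_apply, ← evalList_ofFn]
  congr 1
  refine List.ext_getElem (by simp) fun i h₁ h₂ => ?_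
  have hi : i < c.length := by simpa using h₁
  simp only [List.getElem_ofFn, List.getElem_map, List.getElem_splitWrtComposition]
  refine p.congr ?_ fun j h₃ h₄ => by simp
  have := c.sizeUpTo_succ hi
  have := c.sizeUpTo_le (i + 1)
  simp only [List.length_drop, List.length_take, Composition.blocksFun, List.get_eq_getElem]
  omega

lemma eventually_summable_norm {p : FormalMultilinearSeries 𝕜 V W} (hp : 0 < p.radius) :
    ∀ᶠ v in 𝓝 (0 : V), Summable fun n => ‖p n fun _ => v‖ := by
  filter_upwards [Metric.eball_mem_nhds (0 : V) hp] with v hv using p.summable_norm_apply hv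

variable [CompleteSpace V] [CompleteSpace W]

lemma hasFPowerSeriesAt_comp_sum {q : FormalMultilinearSeries 𝕜 V W}
    {p : FormalMultilinearSeries 𝕜 U V} (hq : 0 < q.radius) (hp : 0 < p.radius) (hp₀ : p 0 = 0) :
    HasFPowerSeriesAt (q.sum ∘ p.sum) (q.comp p) 0 := by
  have hsum : p.sum 0 = 0 := by
    rw [← (p.hasFPowerSeriesOnBall hp).coeff_zero fun _ => 0, hp₀, _root_.zero_apply]
  refine HasFPowerSeriesAt.comp ?_ (p.hasFPowerSeriesOnBall hp).hasFPowerSeriesAt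
  rw [hsum]
  exact (q.hasFPowerSeriesOnBall hq).hasFPowerSeriesAt

lemma eventually_sum_sum_eq {q : FormalMultilinearSeries 𝕜 V W}
    {p : FormalMultilinearSeries 𝕜 U V} (hq : 0 < q.radius) (hp : 0 < p.radius) (hp₀ : p 0 = 0) :
    ∀ᶠ v in 𝓝 (0 : U), q.sum (p.sum v) = (q.comp p).sum v := by
  have h := hasFPowerSeriesAt_comp_sum hq hp hp₀
  filter_upwards [h.eventually_hasSum,
    ((q.comp p).hasFPowerSeriesOnBall h.radius_pos).hasFPowerSeriesAt.eventually_hasSum]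
    with v h₁ h₂
  simpa using h₁.unique h₂

end PowerSeries

section CumulantSeries

open FormalMultilinearSeries

variable {𝕜 B : Type*} [NontriviallyNormedField 𝕜] [NormedRing B] [NormedAlgebra 𝕜 B]
  {M : FormalMultilinearSeries 𝕜 B B}

/-- The series `(b₁, …, bₙ) ↦ b₁ M(b₂, …, bₙ)` of `b ↦ b M(b)`. -/
noncomputable def subordinationSeries (M : FormalMultilinearSeries 𝕜 B B) :
    FormalMultilinearSeries 𝕜 B B
  | 0 => 0
  | n + 1 => ((ContinuousLinearMap.compContinuousMultilinearMapL 𝕜 (fun _ : Fin n => B) B B).flip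
      (M n) ∘L ContinuousLinearMap.mul 𝕜 B).uncurryLeft

/-- The free cumulant series `K` of the moment series `M`, determined by
`K(b M(b)) = M(b)`. -/
noncomputable def cumulantSeries (M : FormalMultilinearSeries 𝕜 B B) :
    FormalMultilinearSeries 𝕜 B B :=
  M.comp ((subordinationSeries M).rightInv (ContinuousLinearEquiv.refl 𝕜 B) 0)

lemma evalList_subordinationSeries_cons (y : B) (l : List B) :
    evalList (subordinationSeries M) (y :: l) = y * evalList M l := rfl

lemma subordinationSeries_apply_const (n : ℕ) (b : B) :
    subordinationSeries M (n + 1) (fun _ => b) = b * M n fun _ => b := rfl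

lemma subordinationSeries_one (hM : evalList M [] = 1) : subordinationSeries M 1 =
    (continuousMultilinearCurryFin1 𝕜 B B).symm (ContinuousLinearEquiv.refl 𝕜 B) := by
  ext v
  have hv : v = fun _ => v 0 := funext fun i => by rw [Subsingleton.elim i 0]
  rw [hv, ← evalList_replicate, List.replicate_one, evalList_subordinationSeries_cons, hM, mul_one]
  rfl

lemma cumulantSeries_comp_subordinationSeries (hM : evalList M [] = 1) :
    (cumulantSeries M).comp (subordinationSeries M) = M := by
  have h₁ := subordinationSeries_one hM
  rw [cumulantSeries, comp_assoc, ← leftInv_eq_rightInv _ _ _ h₁, leftInv_comp _ _ _ h₁, comp_id]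

lemma splitSum_subordinationSeries (K : FormalMultilinearSeries 𝕜 B B) (acc l : List B) :
    splitSum (fun L => evalList K (acc ++ L.map (evalList (subordinationSeries M)))) l =
      peel (evalList M) (evalList K) acc l := by
  induction h : l.length using Nat.strong_induction_on generalizing acc l with
  | _ m ih =>
    subst h
    rcases l with _ | ⟨x, l⟩
    · simp [splitSum_nil, peel]
    · rw [splitSum_cons, peel]
      refine Finset.sum_congr rfl fun k hk => ?_
      rw [← ih _ (by grind) _ _ rfl]
      simp [evalList_subordinationSeries_cons]

lemma isMomentCumulantPair_cumulantSeries (hM : evalList M [] = 1) :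
    IsMomentCumulantPair (evalList M) (evalList (cumulantSeries M)) where
  nil := hM
  eq_peel l := by
    conv_lhs => rw [← cumulantSeries_comp_subordinationSeries hM, evalList_comp]
    exact splitSum_subordinationSeries _ [] l

lemma norm_subordinationSeries_succ_le (n : ℕ) : ‖subordinationSeries M (n + 1)‖ ≤ ‖M n‖ := by
  rw [subordinationSeries, ContinuousLinearMap.uncurryLeft_norm]
  refine ContinuousLinearMap.opNorm_le_bound _ (norm_nonneg _) fun z => ?_
  calc ‖(ContinuousLinearMap.mul 𝕜 B z).compContinuousMultilinearMap (M n)‖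
      ≤ ‖ContinuousLinearMap.mul 𝕜 B z‖ * ‖M n‖ :=
        ContinuousLinearMap.norm_compContinuousMultilinearMap_le _ _
    _ ≤ ‖M n‖ * ‖z‖ := by
        rw [mul_comm]
        gcongr
        exact ContinuousLinearMap.opNorm_mul_apply_le 𝕜 B z

lemma radius_le_radius_subordinationSeries (M : FormalMultilinearSeries 𝕜 B B) :
    M.radius ≤ (subordinationSeries M).radius := by
  refine ENNReal.le_of_forall_nnreal_lt fun r hr => ?_
  obtain ⟨C, hC, h⟩ := M.norm_mul_pow_le_of_lt_radius hr
  refine (subordinationSeries M).le_radius_of_bound (C * r) fun n => ?_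
  rcases n with _ | n
  · simpa [subordinationSeries] using by positivity
  · calc ‖subordinationSeries M (n + 1)‖ * (r : ℝ) ^ (n + 1)
        ≤ ‖M n‖ * (r : ℝ) ^ (n + 1) := by gcongr; exact norm_subordinationSeries_succ_le n
      _ = ‖M n‖ * (r : ℝ) ^ n * r := by ring
      _ ≤ C * r := by gcongr; exact h n

/-- The series `(b₁, …, bₙ) ↦ K(b₁, …, bₙ, 1)`. -/
noncomputable def lastOne (K : FormalMultilinearSeries 𝕜 B B) : FormalMultilinearSeries 𝕜 B B :=
  (ContinuousLinearMap.apply 𝕜 B (1 : B)).compFormalMultilinearSeries K.shift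

lemma lastOne_apply_const (K : FormalMultilinearSeries 𝕜 B B) (n : ℕ) (b : B) :
    lastOne K n (fun _ => b) = evalList K (List.replicate n b ++ [1]) := by
  have hword : List.replicate n b ++ [1] =
      List.ofFn (Fin.snoc (α := fun _ => B) (fun _ : Fin n => b) 1) := by
    rw [List.ofFn_succ']
    simp
  rw [hword, evalList_ofFn]
  rfl

lemma radius_lastOne_pos {K : FormalMultilinearSeries 𝕜 B B} (hK : 0 < K.radius) :
    0 < (lastOne K).radius := by
  rw [← K.radius_shift] at hK
  exact hK.trans_le (K.shift.radius_le_radius_continuousLinearMap_comp _)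

variable [CompleteSpace B]

lemma radius_cumulantSeries_pos (hM : 0 < M.radius) : 0 < (cumulantSeries M).radius :=
  (hasFPowerSeriesAt_comp_sum hM (radius_rightInv_pos_of_radius_pos
    (hM.trans_le (radius_le_radius_subordinationSeries M)))
    (by rw [rightInv_coeff_zero]; rfl)).radius_pos

lemma eventually_sum_subordinationSeries (hM : 0 < M.radius) :
    ∀ᶠ b in 𝓝 (0 : B), (subordinationSeries M).sum b = b * M.sum b := by
  filter_upwards [eventually_summable_norm hM,
    eventually_summable_norm (hM.trans_le (radius_le_radius_subordinationSeries M))] with b h₁ h₂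
  rw [FormalMultilinearSeries.sum, h₂.of_norm.tsum_eq_zero_add, FormalMultilinearSeries.sum,
    ← h₁.of_norm.tsum_mul_left]
  simp only [subordinationSeries_apply_const]
  exact zero_add _

lemma eventually_sum_cumulantSeries (hM : 0 < M.radius) (hM₀ : evalList M [] = 1) :
    ∀ᶠ b in 𝓝 (0 : B), (cumulantSeries M).sum (b * M.sum b) = M.sum b := by
  filter_upwards [eventually_sum_subordinationSeries hM,
    eventually_sum_sum_eq (radius_cumulantSeries_pos hM)
      (hM.trans_le (radius_le_radius_subordinationSeries M)) rfl] with b h₁ h₂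
  rw [← h₁, h₂, cumulantSeries_comp_subordinationSeries hM₀]

lemma eventually_sum_eq_add_sum_lastOne_mul {K : FormalMultilinearSeries 𝕜 B B}
    (hK : 0 < K.radius) (hlin : RightLinear (evalList K)) :
    ∀ᶠ b in 𝓝 (0 : B), K.sum b = evalList K [] + (lastOne K).sum b * b := by
  filter_upwards [eventually_summable_norm hK, eventually_summable_norm (radius_lastOne_pos hK)]
    with b h₁ h₂
  have hzero : K 0 (fun _ => b) = evalList K [] := (evalList_replicate K 0 b).symm
  have hsucc (n : ℕ) : K (n + 1) (fun _ => b) = lastOne K n (fun _ => b) * b := by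
    rw [lastOne_apply_const, ← hlin, one_mul, ← evalList_replicate, List.replicate_succ']
  rw [FormalMultilinearSeries.sum, h₁.of_norm.tsum_eq_zero_add, FormalMultilinearSeries.sum,
    ← h₂.of_norm.tsum_mul_right, hzero]
  simp only [hsucc]

end CumulantSeries

section MomentSeries

open FormalMultilinearSeries

variable {𝕜 V A B : Type*} [NontriviallyNormedField 𝕜] [NormedAddCommGroup V] [NormedSpace 𝕜 V]
  [NormedRing A] [NormedAlgebra 𝕜 A] [NormedRing B] [NormedAlgebra 𝕜 B]

/-- The multilinear moments `E(Θ v₁ ⋯ Θ vₙ)`. The moment of order zero is `1` by convention, `E`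
not being assumed unital. -/
noncomputable def momentSeries (Θ : V →L[𝕜] A) (E : A →L[𝕜] B) : FormalMultilinearSeries 𝕜 V B
  | 0 => ContinuousMultilinearMap.uncurry0 𝕜 V 1
  | n + 1 => E.compContinuousMultilinearMap
      ((ContinuousMultilinearMap.mkPiAlgebraFin 𝕜 (n + 1) A).compContinuousLinearMap fun _ => Θ)

variable {Θ : V →L[𝕜] A} {E : A →L[𝕜] B}

lemma evalList_momentSeries_nil : evalList (momentSeries Θ E) [] = 1 := rfl

lemma evalList_momentSeries {l : List V} (hl : l ≠ []) :
    evalList (momentSeries Θ E) l = E (l.map Θ).prod := by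
  rcases l with _ | ⟨x, l⟩
  · exact absurd rfl hl
  · change E (ContinuousMultilinearMap.mkPiAlgebraFin 𝕜 (l.length + 1) A _) = _
    rw [ContinuousMultilinearMap.mkPiAlgebraFin_apply]
    congr 2
    exact List.ext_getElem (by simp) fun i h₁ h₂ => by simp

lemma momentSeries_apply_const (n : ℕ) (v : V) :
    momentSeries Θ E (n + 1) (fun _ => v) = E (Θ v ^ (n + 1)) := by
  rw [← evalList_replicate, evalList_momentSeries (by simp), List.map_replicate,
    List.prod_replicate]

lemma norm_momentSeries_succ_le (n : ℕ) :
    ‖momentSeries Θ E (n + 1)‖ ≤ ‖E‖ * ‖Θ‖ ^ (n + 1) := by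
  refine (ContinuousLinearMap.norm_compContinuousMultilinearMap_le _ _).trans ?_
  gcongr
  refine (ContinuousMultilinearMap.norm_compContinuousLinearMap_le _ _).trans ?_
  rw [Finset.prod_const, Finset.card_univ, Fintype.card_fin]
  exact mul_le_of_le_one_left (by positivity)
    ContinuousMultilinearMap.norm_mkPiAlgebraFin_succ_le

lemma radius_momentSeries_pos : 0 < (momentSeries Θ E).radius := by
  let r : NNReal := (‖Θ‖₊ + 1)⁻¹
  have hr : ‖Θ‖ * r ≤ 1 := by
    rw [NNReal.coe_inv, NNReal.coe_add, coe_nnnorm, NNReal.coe_one, ← div_eq_mul_inv]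
    exact div_le_one_of_le₀ (by linarith) (by positivity)
  refine lt_of_lt_of_le (ENNReal.coe_pos.2 (by positivity : 0 < r))
    ((momentSeries Θ E).le_radius_of_bound (max ‖momentSeries Θ E 0‖ ‖E‖) fun n => ?_)
  rcases n with _ | n
  · simp
  · calc ‖momentSeries Θ E (n + 1)‖ * (r : ℝ) ^ (n + 1)
        ≤ ‖E‖ * ‖Θ‖ ^ (n + 1) * (r : ℝ) ^ (n + 1) := by
          gcongr; exact norm_momentSeries_succ_le n
      _ = ‖E‖ * (‖Θ‖ * r) ^ (n + 1) := by rw [mul_pow, mul_assoc]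
      _ ≤ ‖E‖ := mul_le_of_le_one_right (norm_nonneg _) (pow_le_one₀ (by positivity) hr)
      _ ≤ _ := le_max_right _ _

lemma eventually_hasSum_pow_succ [CompleteSpace B] (Θ : V →L[𝕜] A) (E : A →L[𝕜] B) :
    ∀ᶠ v in 𝓝 0, HasSum (fun n : ℕ => E (Θ v ^ (n + 1))) ((momentSeries Θ E).sum v - 1) := by
  filter_upwards [eventually_summable_norm (radius_momentSeries_pos (Θ := Θ) (E := E))] with v hv
  have h := (hasSum_nat_add_iff' 1).2 hv.of_norm.hasSum
  simp only [momentSeries_apply_const, Finset.sum_range_one] at h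
  exact h

end MomentSeries

section GeometricSeries

variable {𝕜 A V : Type*} [NontriviallyNormedField 𝕜] [NormedRing A] [NormedAlgebra 𝕜 A]
  [NormedAddCommGroup V] [NormedSpace 𝕜 V] (E : A →L[𝕜] V) (W : A) {Z : A}

lemma summable_norm_apply_mul_pow (hZ : ‖Z‖ < 1) : Summable fun n : ℕ => ‖E (W * Z ^ n)‖ := by
  refine .of_nonneg_of_le (fun n => norm_nonneg _) (fun n => ?_)
    ((summable_norm_geometric_of_norm_lt_one hZ).mul_left (‖E‖ * ‖W‖))
  rw [mul_assoc]
  exact E.le_opNorm_of_le (norm_mul_le _ _)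

lemma hasSum_apply_mul_pow [CompleteSpace A] (hZ : ‖Z‖ < 1) :
    HasSum (fun n : ℕ => E (W * Z ^ n)) (E (W * Ring.inverse (1 - Z))) := by
  rw [← geom_series_eq_inverse Z hZ]
  exact E.hasSum ((summable_geometric_of_norm_lt_one hZ).hasSum.mul_left W)

end GeometricSeries

section WordModels

variable {n : ℕ}

lemma sort_eq_filter_finRange (V : Finset (Fin n)) :
    V.sort (· ≤ ·) = (List.finRange n).filter (· ∈ V) :=
  (Finset.sortedLT_sort V).pairwise.eq_of_mem_iff ((List.pairwise_lt_finRange n).filter _)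
    fun v => by simp

lemma sort_eq_reverse_map_rev (V : Finset (Fin n)) :
    V.sort (· ≤ ·) = (((List.finRange n).filter (Fin.rev · ∈ V)).map Fin.rev).reverse := by
  refine (Finset.sortedLT_sort V).pairwise.eq_of_mem_iff ?_ fun v => ?_
  · rw [List.pairwise_reverse, List.pairwise_map]
    exact ((List.pairwise_lt_finRange n).filter _).imp Fin.rev_lt_rev.2
  · simp only [Finset.mem_sort, List.mem_reverse, List.mem_map, List.mem_filter, List.mem_finRange,
      decide_eq_true_eq, true_and]
    exact ⟨fun hv => ⟨v.rev, by simpa using hv, v.rev_rev⟩, by rintro ⟨w, hw, rfl⟩; exact hw⟩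

namespace BBSpace

variable {B A : Type*} [Ring B] [Algebra ℂ B] [Ring A] [Algebra ℂ A] (P : BBSpace B A)

lemma L_mul (b c : B) : P.L (b * c) = P.L b * P.L c := by
  rw [L, L, L, ← map_mul, Algebra.TensorProduct.tmul_mul_tmul, one_mul]

lemma R_mul (b c : B) : P.R (b * c) = P.R c * P.R b := by
  rw [R, R, R, ← map_mul, Algebra.TensorProduct.tmul_mul_tmul, one_mul, MulOpposite.op_mul]

lemma L_one : P.L 1 = 1 := P.ε.map_one

lemma R_one : P.R 1 = 1 := P.ε.map_one

lemma commute_R_L (b c : B) : P.R c * P.L b = P.L b * P.R c := by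
  rw [L, R, ← map_mul, ← map_mul, Algebra.TensorProduct.tmul_mul_tmul,
    Algebra.TensorProduct.tmul_mul_tmul]
  simp only [one_mul, mul_one]

lemma E_L_mul (b : B) (Z : A) : P.E (P.L b * Z) = b * P.E Z := by
  have h := P.E_ε_mul b 1 Z
  rwa [mul_one] at h

lemma E_R_mul (b : B) (Z : A) : P.E (P.R b * Z) = P.E Z * b := by
  have h := P.E_ε_mul 1 b Z
  rwa [one_mul] at h

lemma L_mem_leftAlg (b : B) : P.L b ∈ P.leftAlg := by
  refine (Subalgebra.mem_centralizer_iff ℂ).2 ?_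
  rintro _ ⟨c, rfl⟩
  exact P.commute_R_L b c

lemma E_mul_L_of_mem_leftAlg {Z : A} (hZ : Z ∈ P.leftAlg) (b : B) :
    P.E (Z * P.L b) = P.E Z * b := by
  have hcomm : P.R b * Z = Z * P.R b := (Subalgebra.mem_centralizer_iff ℂ).1 hZ _ ⟨b, rfl⟩
  rw [← P.E_R_mul, hcomm]
  exact P.E_mul_ε b Z

lemma isWordModel_left (X : A) (b : B) {F : List B → B}
    (hF : ∀ l, l ≠ [] → P.E (l.map fun y => P.L b * X * P.L y).prod = F l) :
    IsWordModel P (fun _ : Fin n => Side.left) (Equiv.refl _) F fun y => P.L b * X * P.L y where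
  blockMoment_eq V Z y hV hZ := by
    have hne : ((List.finRange n).filter (· ∈ V)).map y ≠ [] := by
      obtain ⟨v, hv⟩ := hV
      simpa using ⟨v, hv⟩
    rw [blockMoment, sort_eq_filter_finRange]
    refine Eq.trans ?_ (hF _ hne)
    have hword : ((List.finRange n).filter (· ∈ V)).map Z =
        ((List.finRange n).filter (· ∈ V)).map fun v => P.L b * X * P.L (y v) :=
      List.map_congr_left fun v hv => hZ v (by simpa using hv)
    rw [hword, List.map_map]
    rfl
  mul_L _ _ c d := by rw [P.L_mul, mul_assoc]
  R_mul _ h := by cases h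

lemma isWordModel_right (Y : A) (d : B) {F : List B → B}
    (hF : ∀ l, l ≠ [] → P.E (l.map fun y => P.R y * (P.R d * Y)).reverse.prod = F l) :
    IsWordModel P (fun _ : Fin n => Side.right) Fin.revPerm F fun y => P.R y * (P.R d * Y) where
  blockMoment_eq V Z y hV hZ := by
    have hne : ((List.finRange n).filter (Fin.rev · ∈ V)).map y ≠ [] := by
      obtain ⟨v, hv⟩ := hV
      simpa using ⟨v.rev, by simpa using hv⟩
    rw [blockMoment, sort_eq_reverse_map_rev, List.map_reverse, List.map_map]
    refine Eq.trans ?_ (hF _ hne)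
    have hword : ((List.finRange n).filter (Fin.rev · ∈ V)).map (Z ∘ Fin.rev) =
        ((List.finRange n).filter (Fin.rev · ∈ V)).map fun v => P.R (y v) * (P.R d * Y) :=
      List.map_congr_left fun v hv => hZ v (by simpa using hv)
    rw [hword, List.map_map]
    rfl
  mul_L _ h := by cases h
  R_mul _ _ c d := by rw [P.R_mul, mul_assoc]

end BBSpace

end WordModels

section Germs

variable {B : Type*} [NormedRing B]

namespace IsCompInverse

variable {F F' G G' m m' : B → B}

lemma tendsto (h : IsCompInverse F G) : Tendsto G (𝓝 0) (𝓝 0) := by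
  simpa only [h.1] using h.2.1.tendsto

lemma congr_left (h : IsCompInverse F G) (hF : F =ᶠ[𝓝 0] F') : IsCompInverse F' G := by
  refine ⟨h.1, h.2.1, ?_, ?_⟩
  · filter_upwards [h.tendsto.eventually hF, h.2.2.1] with b h₁ h₂
    rw [← h₁, h₂]
  · filter_upwards [hF, h.2.2.2] with b h₁ h₂
    rw [← h₁, h₂]

lemma unique (h : IsCompInverse F G) (h' : IsCompInverse F G') : G =ᶠ[𝓝 0] G' := by
  filter_upwards [h.tendsto.eventually h'.2.2.2, h.2.2.1] with b h₁ h₂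
  rw [← h₁, h₂]

lemma of_comp_eq (hG : IsCompInverse F G) (hm : IsCompInverse m m') (hm₀ : m 0 = 0)
    (hmc : ContinuousAt m 0) (hF' : ∀ᶠ b in 𝓝 0, F' (m b) = F b) :
    IsCompInverse F' fun b => m (G b) := by
  have hm'F : ∀ᶠ b in 𝓝 0, G (F (m' b)) = m' b := hm.tendsto.eventually hG.2.2.2
  refine ⟨(congrArg m hG.1).trans hm₀, ContinuousAt.comp (by rwa [hG.1]) hG.2.1, ?_, ?_⟩
  · filter_upwards [hG.tendsto.eventually hF', hG.2.2.1] with b h₁ h₂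
    rw [h₁, h₂]
  · filter_upwards [hm.tendsto.eventually hF', hm'F, hm.2.2.1] with b h₁ h₂ h₃
    rw [h₃] at h₁
    rw [h₁, h₂, h₃]

end IsCompInverse

lemma tendsto_self_mul_one_add {f : B → B} (hf : ContinuousAt f 0) :
    Tendsto (fun b => b * (1 + f b * b)) (𝓝 0) (𝓝 0) := by
  have hcont : ContinuousAt (fun b => b * (1 + f b * b)) 0 :=
    continuousAt_id.mul (continuousAt_const.add (hf.mul continuousAt_id))
  simpa only [zero_mul] using hcont.tendsto

variable [NormedAlgebra ℂ B]

lemma isInvertible_mulLeft {u : B} (hu : IsUnit u) :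
    (ContinuousLinearMap.mul ℂ B u).IsInvertible := by
  obtain ⟨u, rfl⟩ := hu
  refine .of_inverse (g := ContinuousLinearMap.mul ℂ B (u⁻¹ : Bˣ)) ?_ ?_ <;> ext <;> simp

lemma isInvertible_mulRight {u : B} (hu : IsUnit u) :
    ((ContinuousLinearMap.mul ℂ B).flip u).IsInvertible := by
  obtain ⟨u, rfl⟩ := hu
  refine .of_inverse (g := (ContinuousLinearMap.mul ℂ B).flip (u⁻¹ : Bˣ)) ?_ ?_ <;> ext <;> simp

lemma IsLeftQuotient.one_add_mul {H T : B → B} (h : IsLeftQuotient H T) :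
    IsLeftQuotient (fun b => (1 + b) * H b) fun b => (1 + b) * T b := by
  refine ⟨(analyticAt_const.add analyticAt_id).mul h.1, ?_⟩
  filter_upwards [h.2] with b hb
  rw [hb]
  noncomm_ring

lemma IsRightQuotient.mul_one_add {H T : B → B} (h : IsRightQuotient H T) :
    IsRightQuotient (fun d => H d * (1 + d)) fun d => T d * (1 + d) := by
  refine ⟨h.1.mul (analyticAt_const.add analyticAt_id), ?_⟩
  filter_upwards [h.2] with d hd
  rw [hd]
  noncomm_ring

variable [CompleteSpace B]

lemma eventually_eq_zero_of_isUnit {V : Type*} [NormedAddCommGroup V] [NormedSpace ℂ V]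
    [CompleteSpace V] {f : B → V} (hf : AnalyticAt ℂ f 0) (h : ∀ᶠ b in 𝓝 0, IsUnit b → f b = 0) :
    ∀ᶠ b in 𝓝 0, f b = 0 := by
  obtain ⟨r, hr, hfr⟩ := hf.exists_ball_analyticOnNhd
  have hscalars : Tendsto (algebraMap ℂ B) (𝓝[≠] 0) (𝓝 0) := by
    have h0 := (algebraMapCLM ℂ B).continuous.tendsto 0
    rw [map_zero] at h0
    exact h0.mono_left nhdsWithin_le_nhds
  have hball : ∀ᶠ b in 𝓝 (0 : B), b ∈ Metric.ball 0 r := Metric.ball_mem_nhds 0 hr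
  obtain ⟨t, ⟨ht, hzero⟩, ht0⟩ :=
    ((hscalars.eventually (hball.and h.eventually_nhds)).and self_mem_nhdsWithin).exists
  have hu : IsUnit (algebraMap ℂ B t) := (IsUnit.mk0 t ht0).map _
  have hnear : f =ᶠ[𝓝 (algebraMap ℂ B t)] 0 := by
    filter_upwards [Units.isOpen.mem_nhds hu, hzero] with b hb hb'
    exact hb' hb
  filter_upwards [hball] with b hb
  exact hfr.eqOn_zero_of_preconnected_of_eventuallyEq_zero (convex_ball 0 r).isPreconnected
    ht hnear hb

lemma exists_analyticAt_isCompInverse {F : B → B} (hF : AnalyticAt ℂ F 0) (hF₀ : F 0 = 0)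
    {F' : B →L[ℂ] B} (hF' : HasFDerivAt F F' 0) (hinv : F'.IsInvertible) :
    ∃ G, AnalyticAt ℂ G 0 ∧ IsCompInverse F G := by
  obtain ⟨e, rfl⟩ := hinv
  have hs := hF.contDiffAt.hasStrictFDerivAt' hF' (n := ⊤) (by simp)
  have hG := (hF.contDiffAt (n := ⊤)).to_localInverse hF' (by simp)
  rw [hF₀] at hG
  refine ⟨hs.localInverse F e 0, hG.analyticAt, ?_, hG.continuousAt, ?_, hs.eventually_left_inverse⟩
  · simpa only [hF₀] using hs.localInverse_apply_image
  · simpa only [hF₀] using hs.eventually_right_inverse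

lemma exists_analyticAt_isCompInverse_id_mul {f : B → B} (hf : AnalyticAt ℂ f 0)
    (hu : IsUnit (f 0)) : ∃ H, AnalyticAt ℂ H 0 ∧ IsCompInverse (fun b => b * f b) H := by
  refine exists_analyticAt_isCompInverse (analyticAt_id.mul hf) (zero_mul _) ?_
    (isInvertible_mulRight hu)
  exact ((hasFDerivAt_id (0 : B)).mul' hf.differentiableAt.hasFDerivAt).congr_fderiv
    (by ext; simp)

lemma exists_analyticAt_isCompInverse_mul_id {f : B → B} (hf : AnalyticAt ℂ f 0)
    (hu : IsUnit (f 0)) : ∃ H, AnalyticAt ℂ H 0 ∧ IsCompInverse (fun b => f b * b) H := by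
  refine exists_analyticAt_isCompInverse (hf.mul analyticAt_id) (mul_zero _) ?_
    (isInvertible_mulLeft hu)
  exact (hf.differentiableAt.hasFDerivAt.mul' (hasFDerivAt_id (0 : B))).congr_fderiv
    (by ext; simp)

lemma IsCompInverse.self_mul_one_add_comp {F F' G f : B → B} (hG : IsCompInverse F G)
    (hf : AnalyticAt ℂ f 0) (hF' : ∀ᶠ b in 𝓝 0, F' (b * (1 + f b * b)) = F b) :
    IsCompInverse F' fun b => G b * (1 + f (G b) * G b) := by
  have hg : AnalyticAt ℂ (fun b => 1 + f b * b) 0 :=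
    analyticAt_const.add (hf.mul analyticAt_id)
  obtain ⟨m', -, hm'⟩ := exists_analyticAt_isCompInverse_id_mul hg (by simp)
  exact hG.of_comp_eq hm' (zero_mul _) (continuousAt_id.mul hg.continuousAt) hF'

lemma analyticAt_ringInverse_comp {V : Type*} [NormedAddCommGroup V] [NormedSpace ℂ V]
    {f : V → B} {v : V} (hf : AnalyticAt ℂ f v) (hu : IsUnit (f v)) :
    AnalyticAt ℂ (fun v => Ring.inverse (f v)) v := by
  obtain ⟨u, hu⟩ := hu
  exact (hu ▸ analyticAt_inverse u).comp hf

lemma exists_isCompInverse_isLeftQuotient {f : B → B} (hf : AnalyticAt ℂ f 0)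
    (hu : IsUnit (f 0)) :
    ∃ H T, IsCompInverse (fun b => b * f b) H ∧ IsLeftQuotient H T := by
  obtain ⟨H, hH, hinv⟩ := exists_analyticAt_isCompInverse_id_mul hf hu
  rw [← hinv.1] at hf hu
  refine ⟨H, fun b => Ring.inverse (f (H b)), hinv, analyticAt_ringInverse_comp (hf.comp hH) hu, ?_⟩
  have hunit : ∀ᶠ b in 𝓝 0, IsUnit (f (H b)) :=
    (hf.comp hH).continuousAt.eventually (Units.isOpen.mem_nhds hu)
  filter_upwards [hinv.2.2.1, hunit] with b hb hub
  nth_rw 2 [← hb]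
  rw [mul_assoc, Ring.mul_inverse_cancel _ hub, mul_one]

lemma exists_isCompInverse_isRightQuotient {f : B → B} (hf : AnalyticAt ℂ f 0)
    (hu : IsUnit (f 0)) :
    ∃ H T, IsCompInverse (fun b => f b * b) H ∧ IsRightQuotient H T := by
  obtain ⟨H, hH, hinv⟩ := exists_analyticAt_isCompInverse_mul_id hf hu
  rw [← hinv.1] at hf hu
  refine ⟨H, fun b => Ring.inverse (f (H b)), hinv, analyticAt_ringInverse_comp (hf.comp hH) hu, ?_⟩
  have hunit : ∀ᶠ b in 𝓝 0, IsUnit (f (H b)) :=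
    (hf.comp hH).continuousAt.eventually (Units.isOpen.mem_nhds hu)
  filter_upwards [hinv.2.2.1, hunit] with b hb hub
  nth_rw 3 [← hb]
  rw [← mul_assoc, Ring.inverse_mul_cancel _ hub, one_mul]

lemma IsLeftQuotient.unique {G G' θ θ' : B → B} (h : IsLeftQuotient G θ)
    (h' : IsLeftQuotient G' θ') (hG : G =ᶠ[𝓝 0] G') : θ =ᶠ[𝓝 0] θ' := by
  refine (eventually_eq_zero_of_isUnit (h.1.sub h'.1) ?_).mono fun b => sub_eq_zero.1
  filter_upwards [hG, h.2, h'.2] with b h₁ h₂ h₃ hb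
  exact sub_eq_zero.2 (hb.mul_left_cancel (by rw [← h₂, ← h₃, h₁]))

lemma IsRightQuotient.unique {G G' θ θ' : B → B} (h : IsRightQuotient G θ)
    (h' : IsRightQuotient G' θ') (hG : G =ᶠ[𝓝 0] G') : θ =ᶠ[𝓝 0] θ' := by
  refine (eventually_eq_zero_of_isUnit (h.1.sub h'.1) ?_).mono fun b => sub_eq_zero.1
  filter_upwards [hG, h.2, h'.2] with b h₁ h₂ h₃ hb
  exact sub_eq_zero.2 (hb.mul_right_cancel (by rw [← h₂, ← h₃, h₁]))

lemma eventually_self_mul_eq_mul {f k : B → B} (hf : AnalyticAt ℂ f 0) (hk : AnalyticAt ℂ k 0)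
    (h : ∀ᶠ b in 𝓝 0, k (b * (1 + f b * b)) * (b * (1 + f b * b)) = f b * b) :
    ∀ᶠ b in 𝓝 0, b * (1 + f b * b) * k (b * (1 + f b * b)) = b * f b := by
  have hunit : ∀ᶠ b in 𝓝 0, IsUnit (1 + f b * b) := by
    have hcont : ContinuousAt (fun b => 1 + f b * b) 0 :=
      continuousAt_const.add (hf.continuousAt.mul continuousAt_id)
    exact hcont.eventually (Units.isOpen.mem_nhds (by simp))
  have hm : AnalyticAt ℂ (fun b => b * (1 + f b * b)) 0 :=
    analyticAt_id.mul (analyticAt_const.add (hf.mul analyticAt_id))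
  have hkm : AnalyticAt ℂ (fun b => k (b * (1 + f b * b))) 0 :=
    AnalyticAt.fun_comp (by simpa only [zero_mul] using hk) hm
  have hdiff : AnalyticAt ℂ (fun b => b * (1 + f b * b) * k (b * (1 + f b * b)) - b * f b) 0 :=
    (hm.mul hkm).sub (analyticAt_id.mul hf)
  refine (eventually_eq_zero_of_isUnit hdiff ?_).mono fun b => sub_eq_zero.1
  filter_upwards [h, hunit] with b hb hu hbu
  refine sub_eq_zero.2 ((hbu.mul hu).mul_right_cancel ?_)
  rw [mul_assoc, hb]
  noncomm_ring

end Germs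

namespace BBSpace

section CumulantTerms

variable {B A : Type*} [NormedRing B] [NormedAlgebra ℂ B] [NormedRing A] [NormedAlgebra ℂ A]
  (P : BBSpace B A) {X Y : A} {E : A →L[ℂ] B}

lemma prod_map_L_mul_mul_L (X : A) (b : B) (l : List B) :
    (l.map fun y => P.L b * X * P.L y).prod * P.L b =
      P.L b * ((l.map (· * b)).map fun y => X * P.L y).prod := by
  induction l with
  | nil => simp
  | cons y l ih =>
    simp only [List.map_cons, List.prod_cons]
    rw [mul_assoc, ih, P.L_mul]
    noncomm_ring

lemma rightLinear_evalList_left (hX : X ∈ P.leftAlg) {Θ : B →L[ℂ] A}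
    (hΘ : ∀ y, Θ y = X * P.L y) (hE : ∀ Z, E Z = P.E Z) :
    RightLinear (evalList (momentSeries Θ E)) := by
  intro l y b
  have hmem : ((l ++ [y]).map Θ).prod ∈ P.leftAlg := by
    refine Subalgebra.list_prod_mem _ fun Z hZ => ?_
    obtain ⟨w, -, rfl⟩ := List.mem_map.1 hZ
    exact hΘ w ▸ mul_mem hX (P.L_mem_leftAlg w)
  rw [evalList_momentSeries (by simp), evalList_momentSeries (by simp), hE, hE,
    ← P.E_mul_L_of_mem_leftAlg hmem]
  simp [hΘ, P.L_mul, mul_assoc]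

lemma rightLinear_evalList_right (Y : A) {Θ : B →L[ℂ] Aᵐᵒᵖ}
    (hΘ : ∀ y, Θ y = .op (P.R y * Y)) {E : Aᵐᵒᵖ →L[ℂ] B} (hE : ∀ Z, E Z = P.E Z.unop) :
    RightLinear (evalList (momentSeries Θ E)) := by
  intro l y b
  rw [evalList_momentSeries (by simp), evalList_momentSeries (by simp), hE, hE, ← P.E_R_mul]
  simp [hΘ, P.R_mul, mul_assoc]

lemma leftCumulantTerm_succ (hX : X ∈ P.leftAlg) {Θ : B →L[ℂ] A}
    (hΘ : ∀ y, Θ y = X * P.L y) (hE : ∀ Z, E Z = P.E Z) (n : ℕ) (b : B) :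
    P.leftCumulantTerm X (n + 1) b =
      b * lastOne (cumulantSeries (momentSeries Θ E)) n fun _ => b := by
  have hlin := P.rightLinear_evalList_left hX hΘ hE
  have hpair := isMomentCumulantPair_cumulantSeries (evalList_momentSeries_nil (Θ := Θ) (E := E))
  have hadd : AdditiveInEntries (evalList (cumulantSeries (momentSeries Θ E))) :=
    evalList_append_add _
  have hword : ∀ l, l ≠ [] → P.E (l.map fun y => P.L b * X * P.L y).prod =
      leftTwist b (evalList (momentSeries Θ E)) l := by
    intro l hl
    obtain ⟨l, y, rfl⟩ := (List.eq_nil_or_concat' l).resolve_left hl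
    calc P.E ((l ++ [y]).map fun y => P.L b * X * P.L y).prod
        = P.E ((l.map fun y => P.L b * X * P.L y).prod * P.L b * (X * P.L y)) := by
          simp [mul_assoc]
      _ = b * evalList (momentSeries Θ E) (l.map (· * b) ++ [y]) := by
          rw [P.prod_map_L_mul_mul_L, mul_assoc, P.E_L_mul, evalList_momentSeries (by simp), hE]
          simp [hΘ, Function.comp_def]
      _ = leftTwist b (evalList (momentSeries Θ E)) (l ++ [y]) := (leftTwist_concat ..).symm
  have h := (P.isWordModel_left X b hword).cumulant_full_eq (isChiEnumeration_left (n + 1))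
    (hpair.leftTwist hlin) hlin.leftTwist hadd.leftTwist n.succ_pos 1
  rw [List.replicate_succ', leftTwist_concat, List.map_replicate, one_mul] at h
  rw [lastOne_apply_const, ← h, P.L_one, mul_one]
  rfl

lemma rightCumulantTerm_succ (Y : A) {Θ : B →L[ℂ] Aᵐᵒᵖ}
    (hΘ : ∀ y, Θ y = .op (P.R y * Y)) {E : Aᵐᵒᵖ →L[ℂ] B} (hE : ∀ Z, E Z = P.E Z.unop)
    (n : ℕ) (d : B) :
    P.rightCumulantTerm Y (n + 1) d =
      cumulantSeries (momentSeries Θ E) (n + 1) fun _ => d := by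
  have hlin := P.rightLinear_evalList_right Y hΘ hE
  have hpair := isMomentCumulantPair_cumulantSeries (evalList_momentSeries_nil (Θ := Θ) (E := E))
  have hadd : AdditiveInEntries (evalList (cumulantSeries (momentSeries Θ E))) :=
    evalList_append_add _
  have hword : ∀ l, l ≠ [] → P.E (l.map fun y => P.R y * (P.R d * Y)).reverse.prod =
      rightTwist d (evalList (momentSeries Θ E)) l := by
    intro l hl
    rw [rightTwist, evalList_momentSeries (by simpa using hl), hE, MulOpposite.unop_list_prod]
    simp [hΘ, P.R_mul, mul_assoc, Function.comp_def]
  have h := (P.isWordModel_right Y d hword).cumulant_full_eq (isChiEnumeration_right (n + 1))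
    hpair.rightTwist hlin.rightTwist hadd.rightTwist n.succ_pos 1
  rw [rightTwist, List.map_replicate, mul_one, evalList_replicate] at h
  rw [← h, P.R_one, one_mul]
  rfl

end CumulantTerms

end BBSpace

section Resolvent

variable {A B V : Type*} [NormedRing A] [NormedAlgebra ℂ A] [NormedAddCommGroup B] [NormedSpace ℂ B]
  [NormedAddCommGroup V] [NormedSpace ℂ V] (E : A →L[ℂ] V) (Λ : B →L[ℂ] A) (Z : A)

lemma eventually_norm_map_mul_lt_one : ∀ᶠ b in 𝓝 0, ‖Λ b * Z‖ < 1 := by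
  have hcont : Continuous fun b => ‖Λ b * Z‖ := by fun_prop
  exact hcont.continuousAt.eventually_lt continuousAt_const (by simp)

lemma analyticAt_apply_mul_inverse_one_sub [CompleteSpace A] (W : A) :
    AnalyticAt ℂ (fun b => E (W * Ring.inverse (1 - Λ b * Z))) 0 := by
  have hinv : AnalyticAt ℂ (fun b => Ring.inverse (1 - Λ b * Z)) 0 :=
    analyticAt_ringInverse_comp (f := fun b => 1 - Λ b * Z)
      (analyticAt_const.sub ((Λ.analyticAt 0).mul analyticAt_const)) (by simp)
  exact (E.analyticAt _).fun_comp (analyticAt_const.mul hinv)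

end Resolvent

namespace BBSpace

section Transforms

variable {B A : Type*} [NormedRing B] [NormedAlgebra ℂ B] [NormedRing A] [NormedAlgebra ℂ A]
  {P : BBSpace B A}

lemma IsBanach.exists_E (hP : P.IsBanach) : ∃ E : A →L[ℂ] B, ∀ Z, E Z = P.E Z := by
  obtain ⟨C, hC⟩ := hP.bounded_E
  exact ⟨P.E.mkContinuous C hC, fun Z => rfl⟩

lemma IsBanach.exists_L (hP : P.IsBanach) : ∃ Λ : B →L[ℂ] A, ∀ b, Λ b = P.L b := by
  obtain ⟨C, hC⟩ := hP.bounded_L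
  exact ⟨(P.ε.toLinearMap ∘ₗ (TensorProduct.mk ℂ B Bᵐᵒᵖ).flip 1).mkContinuous C hC, fun b => rfl⟩

lemma IsBanach.exists_R (hP : P.IsBanach) : ∃ Λ : B →L[ℂ] A, ∀ b, Λ b = P.R b := by
  obtain ⟨C, hC⟩ := hP.bounded_R
  exact ⟨(P.ε.toLinearMap ∘ₗ TensorProduct.mk ℂ B Bᵐᵒᵖ 1 ∘ₗ
    (MulOpposite.opLinearEquiv ℂ).toLinearMap).mkContinuous C hC, fun b => rfl⟩

lemma IsBanach.exists_leftModel (hP : P.IsBanach) (X : A) :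
    ∃ (Θ : B →L[ℂ] A) (E : A →L[ℂ] B), (∀ b, Θ b = X * P.L b) ∧ ∀ Z, E Z = P.E Z := by
  obtain ⟨E, hE⟩ := hP.exists_E
  obtain ⟨Λ, hΛ⟩ := hP.exists_L
  exact ⟨ContinuousLinearMap.mul ℂ A X ∘L Λ, E, fun b => congrArg (X * ·) (hΛ b), hE⟩

lemma IsBanach.exists_rightOpModel (hP : P.IsBanach) (Y : A) :
    ∃ (Θ : B →L[ℂ] Aᵐᵒᵖ) (E : Aᵐᵒᵖ →L[ℂ] B),
      (∀ d, Θ d = .op (P.R d * Y)) ∧ ∀ Z, E Z = P.E Z.unop := by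
  obtain ⟨E, hE⟩ := hP.exists_E
  obtain ⟨Λ, hΛ⟩ := hP.exists_R
  let op : A ≃L[ℂ] Aᵐᵒᵖ := MulOpposite.opContinuousLinearEquiv ℂ
  exact ⟨op.toContinuousLinearMap ∘L (ContinuousLinearMap.mul ℂ A).flip Y ∘L Λ,
    E ∘L op.symm.toContinuousLinearMap, fun d => congrArg (fun a => MulOpposite.op (a * Y)) (hΛ d),
    fun Z => hE Z.unop⟩

lemma E_L_mul_pow_succ (X : A) (b : B) (n : ℕ) :
    P.E ((P.L b * X) ^ (n + 1)) = b * P.E (X * (P.L b * X) ^ n) := by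
  rw [pow_succ', mul_assoc, P.E_L_mul]

lemma E_R_mul_pow_succ (Y : A) (d : B) (n : ℕ) :
    P.E ((P.R d * Y) ^ (n + 1)) = P.E (Y * (P.R d * Y) ^ n) * d := by
  rw [pow_succ', mul_assoc, P.E_R_mul]

lemma E_mul_L_pow_succ {X : A} (hX : X ∈ P.leftAlg) (b : B) (n : ℕ) :
    P.E ((X * P.L b) ^ (n + 1)) = P.E (X * (P.L b * X) ^ n) * b := by
  have hmem : X * (P.L b * X) ^ n ∈ P.leftAlg :=
    mul_mem hX (pow_mem (mul_mem (P.L_mem_leftAlg b) hX) n)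
  rw [← P.E_mul_L_of_mem_leftAlg hmem, pow_succ, ← mul_assoc, mul_pow_mul]

/-- The resolvent form `E(X (1 - L_b X)⁻¹)` of the analytic function `b⁻¹ Ψ_{ℓ,X}(b)`. -/
noncomputable def leftPsiQuotient (P : BBSpace B A) (X : A) (b : B) : B :=
  P.E (X * Ring.inverse (1 - P.L b * X))

/-- The resolvent form `E(Y (1 - R_d Y)⁻¹)` of the analytic function `Ψ_{r,Y}(d) d⁻¹`. -/
noncomputable def rightPsiQuotient (P : BBSpace B A) (Y : A) (d : B) : B :=
  P.E (Y * Ring.inverse (1 - P.R d * Y))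

lemma leftPsiQuotient_zero (X : A) : P.leftPsiQuotient X 0 = P.E X := by
  simp [leftPsiQuotient, L]

lemma rightPsiQuotient_zero (Y : A) : P.rightPsiQuotient Y 0 = P.E Y := by
  simp [rightPsiQuotient, R]

lemma IsBanach.eventually_summable_leftPsi (hP : P.IsBanach) (X : A) :
    ∀ᶠ b in 𝓝 0, Summable fun n : ℕ => ‖P.E ((P.L b * X) ^ (n + 1))‖ := by
  obtain ⟨E, hE⟩ := hP.exists_E
  obtain ⟨Λ, hΛ⟩ := hP.exists_L
  filter_upwards [eventually_norm_map_mul_lt_one Λ X] with b hb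
  refine .of_nonneg_of_le (fun n => norm_nonneg _) (fun n => ?_)
    ((summable_norm_apply_mul_pow E X hb).mul_left ‖b‖)
  rw [E_L_mul_pow_succ, hE, hΛ]
  exact norm_mul_le _ _

lemma IsBanach.eventually_summable_rightPsi (hP : P.IsBanach) (Y : A) :
    ∀ᶠ d in 𝓝 0, Summable fun n : ℕ => ‖P.E ((P.R d * Y) ^ (n + 1))‖ := by
  obtain ⟨E, hE⟩ := hP.exists_E
  obtain ⟨Λ, hΛ⟩ := hP.exists_R
  filter_upwards [eventually_norm_map_mul_lt_one Λ Y] with d hd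
  refine .of_nonneg_of_le (fun n => norm_nonneg _) (fun n => ?_)
    ((summable_norm_apply_mul_pow E Y hd).mul_right ‖d‖)
  rw [E_R_mul_pow_succ, hE, hΛ]
  exact norm_mul_le _ _

lemma IsBanach.eventually_summable_leftPhi [CompleteSpace B] (hP : P.IsBanach) {X : A}
    (hX : X ∈ P.leftAlg) :
    ∀ᶠ b in 𝓝 0, Summable fun n : ℕ => ‖P.leftCumulantTerm X (n + 1) b‖ := by
  obtain ⟨Θ, E, hΘ, hE⟩ := hP.exists_leftModel X
  filter_upwards [eventually_summable_norm (radius_lastOne_pos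
    (radius_cumulantSeries_pos (radius_momentSeries_pos (Θ := Θ) (E := E))))] with b hb
  simp only [P.leftCumulantTerm_succ hX hΘ hE]
  exact .of_nonneg_of_le (fun n => norm_nonneg _) (fun n => norm_mul_le _ _) (hb.mul_left ‖b‖)

lemma IsBanach.eventually_summable_rightPhi [CompleteSpace B] (hP : P.IsBanach) (Y : A) :
    ∀ᶠ d in 𝓝 0, Summable fun n : ℕ => ‖P.rightCumulantTerm Y (n + 1) d‖ := by
  obtain ⟨Θ, E, hΘ, hE⟩ := hP.exists_rightOpModel Y
  filter_upwards [eventually_summable_norm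
    (radius_cumulantSeries_pos (radius_momentSeries_pos (Θ := Θ) (E := E)))] with d hd
  simp only [P.rightCumulantTerm_succ Y hΘ hE]
  exact hd.comp_injective (add_left_injective 1)

section Complete

variable [CompleteSpace A]

lemma IsBanach.analyticAt_leftPsiQuotient (hP : P.IsBanach) (X : A) :
    AnalyticAt ℂ (P.leftPsiQuotient X) 0 := by
  obtain ⟨E, hE⟩ := hP.exists_E
  obtain ⟨Λ, hΛ⟩ := hP.exists_L
  unfold leftPsiQuotient
  simpa only [hE, hΛ] using analyticAt_apply_mul_inverse_one_sub E Λ X X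

lemma IsBanach.analyticAt_rightPsiQuotient (hP : P.IsBanach) (Y : A) :
    AnalyticAt ℂ (P.rightPsiQuotient Y) 0 := by
  obtain ⟨E, hE⟩ := hP.exists_E
  obtain ⟨Λ, hΛ⟩ := hP.exists_R
  unfold rightPsiQuotient
  simpa only [hE, hΛ] using analyticAt_apply_mul_inverse_one_sub E Λ Y Y

lemma IsBanach.eventually_hasSum_leftPsiQuotient (hP : P.IsBanach) (X : A) :
    ∀ᶠ b in 𝓝 0, HasSum (fun n : ℕ => P.E (X * (P.L b * X) ^ n)) (P.leftPsiQuotient X b) := by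
  obtain ⟨E, hE⟩ := hP.exists_E
  obtain ⟨Λ, hΛ⟩ := hP.exists_L
  filter_upwards [eventually_norm_map_mul_lt_one Λ X] with b hb
  simpa only [leftPsiQuotient, hE, hΛ] using hasSum_apply_mul_pow E X hb

lemma IsBanach.eventually_hasSum_rightPsiQuotient (hP : P.IsBanach) (Y : A) :
    ∀ᶠ d in 𝓝 0, HasSum (fun n : ℕ => P.E (Y * (P.R d * Y) ^ n)) (P.rightPsiQuotient Y d) := by
  obtain ⟨E, hE⟩ := hP.exists_E
  obtain ⟨Λ, hΛ⟩ := hP.exists_R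
  filter_upwards [eventually_norm_map_mul_lt_one Λ Y] with d hd
  simpa only [rightPsiQuotient, hE, hΛ] using hasSum_apply_mul_pow E Y hd

lemma IsBanach.eventually_leftPsi_eq (hP : P.IsBanach) (X : A) :
    P.leftPsi X =ᶠ[𝓝 0] fun b => b * P.leftPsiQuotient X b := by
  filter_upwards [hP.eventually_hasSum_leftPsiQuotient X] with b hb
  simp only [leftPsi, E_L_mul_pow_succ]
  exact (hb.mul_left b).tsum_eq

lemma IsBanach.eventually_rightPsi_eq (hP : P.IsBanach) (Y : A) :
    P.rightPsi Y =ᶠ[𝓝 0] fun d => P.rightPsiQuotient Y d * d := by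
  filter_upwards [hP.eventually_hasSum_rightPsiQuotient Y] with d hd
  simp only [rightPsi, E_R_mul_pow_succ]
  exact (hd.mul_right d).tsum_eq

variable [CompleteSpace B] {E : A →L[ℂ] B}

lemma IsBanach.eventually_sum_momentSeries_left (hP : P.IsBanach) {X : A} (hX : X ∈ P.leftAlg)
    {Θ : B →L[ℂ] A} (hΘ : ∀ b, Θ b = X * P.L b) (hE : ∀ Z, E Z = P.E Z) :
    (momentSeries Θ E).sum =ᶠ[𝓝 0] fun b => 1 + P.leftPsiQuotient X b * b := by
  filter_upwards [eventually_hasSum_pow_succ Θ E, hP.eventually_hasSum_leftPsiQuotient X]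
    with b hM hN
  simp only [hE, hΘ, E_mul_L_pow_succ hX] at hM
  exact eq_add_of_sub_eq' (hM.unique (hN.mul_right b))

lemma IsBanach.eventually_sum_momentSeries_right (hP : P.IsBanach) (Y : A) {Θ : B →L[ℂ] Aᵐᵒᵖ}
    (hΘ : ∀ d, Θ d = .op (P.R d * Y)) {E : Aᵐᵒᵖ →L[ℂ] B} (hE : ∀ Z, E Z = P.E Z.unop) :
    (momentSeries Θ E).sum =ᶠ[𝓝 0] fun d => 1 + P.rightPsiQuotient Y d * d := by
  filter_upwards [eventually_hasSum_pow_succ Θ E, hP.eventually_hasSum_rightPsiQuotient Y]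
    with d hM hN
  simp only [hE, hΘ, MulOpposite.unop_pow, MulOpposite.unop_op, E_R_mul_pow_succ] at hM
  exact eq_add_of_sub_eq' (hM.unique (hN.mul_right d))

lemma IsBanach.exists_analyticAt_leftPhi_eq (hP : P.IsBanach) {X : A} (hX : X ∈ P.leftAlg) :
    ∃ k : B → B, AnalyticAt ℂ k 0 ∧ (∀ᶠ b in 𝓝 0, P.leftPhi X b = b * k b) ∧
      ∀ᶠ b in 𝓝 0, k (b * (1 + P.leftPsiQuotient X b * b)) *
        (b * (1 + P.leftPsiQuotient X b * b)) = P.leftPsiQuotient X b * b := by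
  obtain ⟨Θ, E, hΘ, hE⟩ := hP.exists_leftModel X
  have hM := radius_momentSeries_pos (Θ := Θ) (E := E)
  have hM₀ := evalList_momentSeries_nil (Θ := Θ) (E := E)
  have hpair := isMomentCumulantPair_cumulantSeries hM₀
  have hK := radius_cumulantSeries_pos hM
  have hk := radius_lastOne_pos hK
  have hlin := hpair.rightLinear_cumulant (P.rightLinear_evalList_left hX hΘ hE)
  refine ⟨(lastOne (cumulantSeries (momentSeries Θ E))).sum,
    (FormalMultilinearSeries.hasFPowerSeriesOnBall _ hk).analyticAt, ?_, ?_⟩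
  · filter_upwards [eventually_summable_norm hk] with b hb
    simp only [leftPhi, P.leftCumulantTerm_succ hX hΘ hE]
    exact hb.of_norm.tsum_mul_left b
  · have hm := tendsto_self_mul_one_add (hP.analyticAt_leftPsiQuotient X).continuousAt
    filter_upwards [hP.eventually_sum_momentSeries_left hX hΘ hE,
      eventually_sum_cumulantSeries hM hM₀,
      hm.eventually (eventually_sum_eq_add_sum_lastOne_mul hK hlin)] with b hMb hKb hkb
    rw [hMb, hkb, hpair.cumulant_nil] at hKb
    exact add_left_cancel hKb

lemma IsBanach.eventually_leftPhi_comp_eq (hP : P.IsBanach) {X : A} (hX : X ∈ P.leftAlg) :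
    ∀ᶠ b in 𝓝 0, P.leftPhi X (b * (1 + P.leftPsiQuotient X b * b)) = P.leftPsi X b := by
  obtain ⟨k, hk, hΦ, hkN⟩ := hP.exists_analyticAt_leftPhi_eq hX
  have hN := hP.analyticAt_leftPsiQuotient X
  filter_upwards [(tendsto_self_mul_one_add hN.continuousAt).eventually hΦ,
    eventually_self_mul_eq_mul hN hk hkN, hP.eventually_leftPsi_eq X] with b hΦb hb hΨ
  rw [hΦb, hb, hΨ]

lemma IsBanach.eventually_rightPhi_comp_eq (hP : P.IsBanach) (Y : A) :
    ∀ᶠ d in 𝓝 0, P.rightPhi Y (d * (1 + P.rightPsiQuotient Y d * d)) = P.rightPsi Y d := by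
  obtain ⟨Θ, E, hΘ, hE⟩ := hP.exists_rightOpModel Y
  have hM := radius_momentSeries_pos (Θ := Θ) (E := E)
  have hM₀ := evalList_momentSeries_nil (Θ := Θ) (E := E)
  have hm := tendsto_self_mul_one_add (hP.analyticAt_rightPsiQuotient Y).continuousAt
  filter_upwards [hP.eventually_sum_momentSeries_right Y hΘ hE,
    eventually_sum_cumulantSeries hM hM₀, hP.eventually_rightPsi_eq Y,
    hm.eventually (eventually_summable_norm (radius_cumulantSeries_pos hM))] with d hMd hK hΨ hd
  have hK₀ (v : Fin 0 → B) : cumulantSeries (momentSeries Θ E) 0 v = 1 := by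
    rw [← (isMomentCumulantPair_cumulantSeries hM₀).cumulant_nil]
    exact congrArg _ (Subsingleton.elim _ _)
  rw [hMd, FormalMultilinearSeries.sum, hd.of_norm.tsum_eq_zero_add, hK₀] at hK
  simp only [rightPhi, P.rightCumulantTerm_succ Y hΘ hE, hΨ]
  exact add_left_cancel hK

lemma IsBanach.exists_isCompInverse_left (hP : P.IsBanach) {X : A} (hX : X ∈ P.leftAlg)
    (hu : IsUnit (P.E X)) :
    ∃ G H T, IsCompInverse (P.leftPhi X) G ∧ IsCompInverse (P.leftPsi X) H ∧
      IsLeftQuotient H T ∧ ∀ᶠ b in 𝓝 0, G b = (1 + b) * H b := by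
  have hN := hP.analyticAt_leftPsiQuotient X
  have hΨ := hP.eventually_leftPsi_eq X
  obtain ⟨H, T, hH, hT⟩ :=
    exists_isCompInverse_isLeftQuotient hN ((P.leftPsiQuotient_zero X).symm ▸ hu)
  replace hH := hH.congr_left hΨ.symm
  refine ⟨_, H, T, hH.self_mul_one_add_comp hN (hP.eventually_leftPhi_comp_eq hX), hH, hT, ?_⟩
  filter_upwards [hH.2.2.1, hH.tendsto.eventually hΨ] with b hb hΨb
  rw [hb] at hΨb
  rw [mul_add, ← mul_assoc, ← hΨb, mul_one, one_add_mul]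

lemma IsBanach.exists_isCompInverse_right (hP : P.IsBanach) {Y : A} (hu : IsUnit (P.E Y)) :
    ∃ G H T, IsCompInverse (P.rightPhi Y) G ∧ IsCompInverse (P.rightPsi Y) H ∧
      IsRightQuotient H T ∧ ∀ᶠ d in 𝓝 0, G d = H d * (1 + d) := by
  have hN := hP.analyticAt_rightPsiQuotient Y
  have hΨ := hP.eventually_rightPsi_eq Y
  obtain ⟨H, T, hH, hT⟩ :=
    exists_isCompInverse_isRightQuotient hN ((P.rightPsiQuotient_zero Y).symm ▸ hu)
  replace hH := hH.congr_left hΨ.symm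
  refine ⟨_, H, T, hH.self_mul_one_add_comp hN (hP.eventually_rightPhi_comp_eq Y), hH, hT, ?_⟩
  filter_upwards [hH.2.2.1, hH.tendsto.eventually hΨ] with d hd hΨd
  rw [hd] at hΨd
  rw [← hΨd]

lemma IsBanach.exists_leftSTransform (hP : P.IsBanach) {X : A} (hX : X ∈ P.leftAlg)
    (hu : IsUnit (P.E X)) : ∃ S, P.IsLeftSTransform X S ∧ P.IsDykemaLeftSTransform X S := by
  obtain ⟨G, H, T, hG, hH, hT, hGH⟩ := hP.exists_isCompInverse_left hX hu
  obtain ⟨hS, hHS⟩ := hT.one_add_mul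
  exact ⟨_, ⟨G, hG, hS, EventuallyEq.trans hGH hHS⟩, H, T, hH, hT, .of_forall fun _ => rfl⟩

lemma IsBanach.exists_rightSTransform (hP : P.IsBanach) {Y : A} (hu : IsUnit (P.E Y)) :
    ∃ S, P.IsRightSTransform Y S ∧ P.IsDykemaRightSTransform Y S := by
  obtain ⟨G, H, T, hG, hH, hT, hGH⟩ := hP.exists_isCompInverse_right hu
  obtain ⟨hS, hHS⟩ := hT.mul_one_add
  exact ⟨_, ⟨G, hG, hS, EventuallyEq.trans hGH hHS⟩, H, T, hH, hT, .of_forall fun _ => rfl⟩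

end Complete

section Uniqueness

variable [CompleteSpace B] {S S' : B → B}

lemma IsLeftSTransform.unique {X : A} (h : P.IsLeftSTransform X S)
    (h' : P.IsLeftSTransform X S') : S =ᶠ[𝓝 0] S' := by
  obtain ⟨G, hG, hS⟩ := h
  obtain ⟨G', hG', hS'⟩ := h'
  exact hS.unique hS' (hG.unique hG')

lemma IsRightSTransform.unique {Y : A} (h : P.IsRightSTransform Y S)
    (h' : P.IsRightSTransform Y S') : S =ᶠ[𝓝 0] S' := by
  obtain ⟨G, hG, hS⟩ := h
  obtain ⟨G', hG', hS'⟩ := h'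
  exact hS.unique hS' (hG.unique hG')

lemma IsDykemaLeftSTransform.unique {X : A} (h : P.IsDykemaLeftSTransform X S)
    (h' : P.IsDykemaLeftSTransform X S') : S =ᶠ[𝓝 0] S' := by
  obtain ⟨H, T, hH, hT, hS⟩ := h
  obtain ⟨H', T', hH', hT', hS'⟩ := h'
  filter_upwards [hS, hS', hT.unique hT' (hH.unique hH')] with b hb hb' hTb
  rw [hb, hb', hTb]

lemma IsDykemaRightSTransform.unique {Y : A} (h : P.IsDykemaRightSTransform Y S)
    (h' : P.IsDykemaRightSTransform Y S') : S =ᶠ[𝓝 0] S' := by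
  obtain ⟨H, T, hH, hT, hS⟩ := h
  obtain ⟨H', T', hH', hT', hS'⟩ := h'
  filter_upwards [hS, hS', hT.unique hT' (hH.unique hH')] with d hd hd' hTd
  rw [hd, hd', hTd]

end Uniqueness

end Transforms

end BBSpace

theorem mainTheorem8_general {B A : Type*} [NormedRing B] [NormedAlgebra ℂ B] [CompleteSpace B]
    [NormedRing A] [NormedAlgebra ℂ A] [CompleteSpace A]
    (P : BBSpace B A) (hP : P.IsBanach) :
    (∀ X ∈ P.leftAlg, IsUnit (P.E X) →
      (∀ᶠ b in 𝓝 (0 : B), Summable fun n : ℕ => ‖P.leftCumulantTerm X (n + 1) b‖) ∧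
      (∀ᶠ b in 𝓝 (0 : B), Summable fun n : ℕ => ‖P.E ((P.L b * X) ^ (n + 1))‖) ∧
      (∃ S, P.IsLeftSTransform X S) ∧ (∃ S, P.IsDykemaLeftSTransform X S) ∧
      ∀ S S' : B → B, P.IsLeftSTransform X S → P.IsDykemaLeftSTransform X S' →
        ∀ᶠ b in 𝓝 (0 : B), S b = S' b) ∧
    (∀ Y : A, IsUnit (P.E Y) →
      (∀ᶠ d in 𝓝 (0 : B), Summable fun n : ℕ => ‖P.rightCumulantTerm Y (n + 1) d‖) ∧
      (∀ᶠ d in 𝓝 (0 : B), Summable fun n : ℕ => ‖P.E ((P.R d * Y) ^ (n + 1))‖) ∧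
      (∃ S, P.IsRightSTransform Y S) ∧ (∃ S, P.IsDykemaRightSTransform Y S) ∧
      ∀ S S' : B → B, P.IsRightSTransform Y S → P.IsDykemaRightSTransform Y S' →
        ∀ᶠ d in 𝓝 (0 : B), S d = S' d) := by
  refine ⟨fun X hX hu => ?_, fun Y hu => ?_⟩
  · obtain ⟨S₀, hS₀, hS₀'⟩ := hP.exists_leftSTransform hX hu
    exact ⟨hP.eventually_summable_leftPhi hX, hP.eventually_summable_leftPsi X, ⟨S₀, hS₀⟩,
      ⟨S₀, hS₀'⟩, fun S S' hS hS' => (hS.unique hS₀).trans (hS₀'.unique hS')⟩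
  · obtain ⟨S₀, hS₀, hS₀'⟩ := hP.exists_rightSTransform hu
    exact ⟨hP.eventually_summable_rightPhi Y, hP.eventually_summable_rightPsi Y, ⟨S₀, hS₀⟩,
      ⟨S₀, hS₀'⟩, fun S S' hS hS' => (hS.unique hS₀).trans (hS₀'.unique hS')⟩

theorem mainTheorem8 {B A : Type*} [NormedRing B] [NormedAlgebra ℂ B] [CompleteSpace B]
    [NormedRing A] [NormedAlgebra ℂ A] [CompleteSpace A]
    (P : BBSpace B A) (hP : P.IsBanach) :
    -- left operators
    (∀ X ∈ P.leftAlg, IsUnit (P.E X) →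
      -- the series defining `Φ` and `Ψ` converge absolutely near zero
      (∀ᶠ b in 𝓝 (0 : B), Summable fun n : ℕ => ‖P.leftCumulantTerm X (n + 1) b‖) ∧
      (∀ᶠ b in 𝓝 (0 : B), Summable fun n : ℕ => ‖P.E ((P.L b * X) ^ (n + 1))‖) ∧
      -- both transforms exist, and they agree near zero
      (∃ S, P.IsLeftSTransform X S) ∧ (∃ S, P.IsDykemaLeftSTransform X S) ∧
      ∀ S S' : B → B, P.IsLeftSTransform X S → P.IsDykemaLeftSTransform X S' →
        ∀ᶠ b in 𝓝 (0 : B), S b = S' b) ∧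
    -- right operators
    (∀ Y ∈ P.rightAlg, IsUnit (P.E Y) →
      (∀ᶠ d in 𝓝 (0 : B), Summable fun n : ℕ => ‖P.rightCumulantTerm Y (n + 1) d‖) ∧
      (∀ᶠ d in 𝓝 (0 : B), Summable fun n : ℕ => ‖P.E ((P.R d * Y) ^ (n + 1))‖) ∧
      (∃ S, P.IsRightSTransform Y S) ∧ (∃ S, P.IsDykemaRightSTransform Y S) ∧
      ∀ S S' : B → B, P.IsRightSTransform Y S → P.IsDykemaRightSTransform Y S' →
        ∀ᶠ d in 𝓝 (0 : B), S d = S' d) := by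
  have h := mainTheorem8_general P hP
  exact ⟨h.1, fun Y _ => h.2 Y⟩
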